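/- Let $E\subset\mathbb{R}^2$ be a bounded convex set with non-empty interior. Write $|E|$ for its area, $P(E)=\mathcal{H}^1(\partial E)$ for its perimeter, and $\mu_E$ for its Gaussian curvature measure: $\mu_E(B)$ is the length of the set of all outer unit normals of $E$ at points of $\partial E\cap B$, for Borel $B\subset\mathbb{R}^2$. Let $\beta>0$. (i) If $\beta\le 1$, then for every such $E$ $$\int_{\mathbb{R}^2}|x|^2\,d\mu_E+2\beta|E|\ \ge\ (1+\beta)\frac{P(E)^2}{2\pi},$$ and also $$\inf_{x_0\in\mathbb{R}^2}\int_{\mathbb{R}^2}|x-x_0|^2\,d\mu_E+2\beta|E|\ \ge\ (1+\beta)\frac{P(E)^2}{2\pi}.$$ (ii) If $\beta\ge \tfrac53$, then for every such $E$ $$\inf_{x_0\in\mathbb{R}^2}\int_{\mathbb{R}^2}|x-x_0|^2\,d\mu_E+2\beta|E|\ \le\ (1+\beta)\frac{P(E)^2}{2\pi}.$$ (iii) The thresholds are sharp: for every $\beta>1$ there is such a set $E$ for which the first inequality in (i) fails, and for every $0<\beta<\tfrac53$ there is such a set $E$ for which the inequality in (ii) fails. (iv) If $\beta<1$, equality holds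 in the first inequality of (i) if and only if $E$ is, up to boundary points, a disc $B_r(0)$ with $r>0$ centred at the origin, and equality holds in the second inequality of (i) if and only if $E$ is, up to boundary points, a disc $B_r(\overline x)$ with $r>0$ and $\overline x\in\mathbb{R}^2$. If $\beta>\tfrac53$, equality holds in (ii) if and only if $E$ is, up to boundary points, a disc $B_r(\overline x)$ with $r>0$ and $\overline x\in\mathbb{R}^2$. (Here ``$E$ is $B_r(\overline x)$ up to boundary points'' means $\operatorname{int}E=B_r(\overline x)$.) -/

import Mathlib

open MeasureTheory Set
open scoped Real

/-- The Euclidean plane. -/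
abbrev Plane : Type := EuclideanSpace ℝ (Fin 2)

/-- The unit vector `(cos θ, sin θ)`. -/
noncomputable def unitVec (θ : ℝ) : Plane := !₂[Real.cos θ, Real.sin θ]

/-- The spherical image of `B` with respect to `E`: all outer unit normal vectors of `E` at the
points of `∂E ∩ B`. -/
def sphericalImage (E B : Set Plane) : Set Plane :=
  {u | ‖u‖ = 1 ∧ ∃ x ∈ B ∩ frontier E, ∀ y ∈ E, inner ℝ (y - x) u ≤ 0}

/-- The arc length of a subset of the unit circle. -/
noncomputable def arcLength (A : Set Plane) : ENNReal :=
  volume {θ : ℝ | θ ∈ Ico 0 (2 * π) ∧ unitVec θ ∈ A}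

/-- The support function of `E` as a function of the angle. -/
noncomputable def supportAngle (E : Set Plane) (θ : ℝ) : ℝ :=
  sSup ((fun y : Plane => inner ℝ y (unitVec θ)) '' E)

/-- The point `p u + p' u'` of the boundary with outer normal `u = (cos θ, sin θ)`, where `p` is the
support function (used only in the construction of the curvature measure below). -/
noncomputable def reverseGauss (E : Set Plane) (θ : ℝ) : Plane :=
  !₂[supportAngle E θ * Real.cos θ - deriv (supportAngle E) θ * Real.sin θ,
     supportAngle E θ * Real.sin θ + deriv (supportAngle E) θ * Real.cos θ]

theorem inner_unitVec (y : Plane) (θ : ℝ) :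
    inner ℝ y (unitVec θ) = y 0 * Real.cos θ + y 1 * Real.sin θ := by
  simp [unitVec, PiLp.inner_apply, Fin.sum_univ_two]
  ring

theorem norm_unitVec (θ : ℝ) : ‖unitVec θ‖ = 1 := by
  simp [unitVec, EuclideanSpace.norm_eq, Fin.sum_univ_two]

theorem supportAngle_bddAbove {E : Set Plane} (hE : Bornology.IsBounded E) (θ : ℝ) :
    BddAbove ((fun y : Plane => inner ℝ y (unitVec θ)) '' E) := by
  obtain ⟨R, hR⟩ := hE.exists_norm_le
  refine ⟨R, ?_⟩
  rintro _ ⟨y, hy, rfl⟩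
  calc inner ℝ y (unitVec θ) ≤ ‖y‖ * ‖unitVec θ‖ := real_inner_le_norm _ _
    _ ≤ R := by rw [norm_unitVec, mul_one]; exact hR y hy

theorem supportAngle_lipschitz {E : Set Plane} (hE : Bornology.IsBounded E) :
    ∃ K, LipschitzWith K (supportAngle E) := by
  rcases E.eq_empty_or_nonempty with rfl | hne
  · refine ⟨0, LipschitzWith.of_dist_le_mul fun a b => ?_⟩
    simp [supportAngle]
  obtain ⟨R, hR0, hR⟩ := hE.exists_pos_norm_le
  refine ⟨Real.toNNReal (R * 2), LipschitzWith.of_le_add_mul _ fun a b => ?_⟩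
  rw [Real.coe_toNNReal _ (by positivity)]
  refine csSup_le (hne.image _) ?_
  rintro _ ⟨y, hy, rfl⟩
  have h1 : inner ℝ y (unitVec b) ≤ supportAngle E b :=
    le_csSup (supportAngle_bddAbove hE b) ⟨y, hy, rfl⟩
  have h2 : |Real.cos a - Real.cos b| ≤ |a - b| := by
    simpa [Real.dist_eq] using Real.lipschitzWith_cos.dist_le_mul a b
  have h3 : |Real.sin a - Real.sin b| ≤ |a - b| := by
    simpa [Real.dist_eq] using Real.lipschitzWith_sin.dist_le_mul a b
  have h4 : ∀ i, |y i| ≤ R := fun i => (PiLp.norm_apply_le y i).trans (hR y hy)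
  have h5 : y 0 * (Real.cos a - Real.cos b) ≤ R * |a - b| :=
    (le_abs_self _).trans (by rw [abs_mul]; gcongr; exact h4 0)
  have h6 : y 1 * (Real.sin a - Real.sin b) ≤ R * |a - b| :=
    (le_abs_self _).trans (by rw [abs_mul]; gcongr; exact h4 1)
  simp only [inner_unitVec] at h1 ⊢
  rw [Real.dist_eq]
  linarith

theorem measurable_reverseGauss {E : Set Plane} (hE : Bornology.IsBounded E) :
    Measurable (reverseGauss E) := by
  obtain ⟨K, hK⟩ := supportAngle_lipschitz hE
  have h1 : Measurable (supportAngle E) := hK.continuous.measurable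
  have h2 : Measurable (deriv (supportAngle E)) := measurable_deriv _
  refine (WithLp.measurable_toLp 2 (Fin 2 → ℝ)).comp ?_
  refine measurable_pi_iff.2 fun i => ?_
  fin_cases i
  · exact (h1.mul Real.measurable_cos).sub (h2.mul Real.measurable_sin)
  · exact (h1.mul Real.measurable_sin).add (h2.mul Real.measurable_cos)

theorem inner_le_supportAngle {E : Set Plane} (hE : Bornology.IsBounded E) {x : Plane}
    (hx : x ∈ closure E) (θ : ℝ) : inner ℝ x (unitVec θ) ≤ supportAngle E θ := by
  have hc : IsClosed {x : Plane | inner ℝ x (unitVec θ) ≤ supportAngle E θ} :=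
    isClosed_le (by fun_prop) continuous_const
  exact closure_minimal (fun y hy => le_csSup (supportAngle_bddAbove hE θ) ⟨y, hy, rfl⟩) hc hx

theorem mem_sphericalImage_iff {E : Set Plane} (hE : Bornology.IsBounded E) (B : Set Plane)
    {θ : ℝ} (hd : DifferentiableAt ℝ (supportAngle E) θ) :
    unitVec θ ∈ sphericalImage E B ↔ reverseGauss E θ ∈ B ∩ frontier E := by
  constructor
  · rintro ⟨-, x, hx, hxy⟩
    have hcl : x ∈ closure E := frontier_subset_closure hx.2
    have hne : E.Nonempty := closure_nonempty_iff.1 ⟨x, hcl⟩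
    have hle := fun φ => inner_le_supportAngle hE hcl φ
    have heq : supportAngle E θ = inner ℝ x (unitVec θ) := by
      refine le_antisymm (csSup_le (hne.image _) ?_) (hle θ)
      rintro _ ⟨y, hy, rfl⟩
      have := hxy y hy
      rw [inner_sub_left] at this
      simpa using this
    have hder : HasDerivAt (fun φ => supportAngle E φ - inner ℝ x (unitVec φ))
        (deriv (supportAngle E) θ - (x 0 * -Real.sin θ + x 1 * Real.cos θ)) θ := by
      refine hd.hasDerivAt.sub ?_
      simp only [inner_unitVec]
      exact ((Real.hasDerivAt_cos θ).const_mul _).add ((Real.hasDerivAt_sin θ).const_mul _)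
    have hmin : IsLocalMin (fun φ => supportAngle E φ - inner ℝ x (unitVec φ)) θ :=
      Filter.Eventually.of_forall fun φ => by
        show supportAngle E θ - inner ℝ x (unitVec θ) ≤ supportAngle E φ - inner ℝ x (unitVec φ)
        linarith [hle φ]
    have h0 := hmin.hasDerivAt_eq_zero hder
    rw [inner_unitVec] at heq
    have h1 : deriv (supportAngle E) θ = x 0 * -Real.sin θ + x 1 * Real.cos θ := by linarith
    have hg : reverseGauss E θ = x := by
      ext i
      fin_cases i
      · simp only [reverseGauss, heq, h1]
        simp
        linear_combination (x 0) * Real.sin_sq_add_cos_sq θ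
      · simp only [reverseGauss, heq, h1]
        simp
        linear_combination (x 1) * Real.sin_sq_add_cos_sq θ
    rwa [hg]
  · intro hx
    refine ⟨norm_unitVec θ, _, hx, fun y hy => ?_⟩
    have h1 := inner_le_supportAngle hE (subset_closure hy) θ
    have h2 : inner ℝ (reverseGauss E θ) (unitVec θ) = supportAngle E θ := by
      rw [inner_unitVec]
      simp [reverseGauss]
      linear_combination (supportAngle E θ) * Real.sin_sq_add_cos_sq θ
    rw [inner_sub_left, h2]
    linarith

theorem arcLength_sphericalImage {E : Set Plane} (hE : Bornology.IsBounded E) {B : Set Plane}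
    (hB : MeasurableSet B) :
    arcLength (sphericalImage E B) =
      (((volume.restrict (Ico 0 (2 * π))).map (reverseGauss E)).restrict (frontier E)) B := by
  obtain ⟨K, hK⟩ := supportAngle_lipschitz hE
  have hm := measurable_reverseGauss hE
  rw [Measure.restrict_apply hB, Measure.map_apply hm (hB.inter isClosed_frontier.measurableSet),
    Measure.restrict_apply (hm (hB.inter isClosed_frontier.measurableSet))]
  refine measure_congr ?_
  filter_upwards [hK.ae_differentiableAt_real] with θ hθ
  refine propext ?_
  show (θ ∈ Ico 0 (2 * π) ∧ unitVec θ ∈ sphericalImage E B) ↔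
    (reverseGauss E θ ∈ B ∩ frontier E ∧ θ ∈ Ico 0 (2 * π))
  rw [mem_sphericalImage_iff hE B hθ, and_comm]

/-- The (Gaussian) curvature measure of a bounded planar set `E` (meant for convex sets with
non-empty interior): the measure of a Borel set `B` is the arc length of the set of all outer unit
normals of `E` at the points of `∂E ∩ B`. -/
noncomputable def curvatureMeasure (E : Set Plane) (hE : Bornology.IsBounded E) : Measure Plane :=
  Measure.ofMeasurable (fun B _ => arcLength (sphericalImage E B))
    (by simp [arcLength, sphericalImage])
    (fun f hf hd => by
      rw [arcLength_sphericalImage hE (MeasurableSet.iUnion hf), measure_iUnion hd hf]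
      exact tsum_congr fun i => (arcLength_sphericalImage hE (hf i)).symm)

/-- Bounded planar convex sets with non-empty interior. -/
structure IsPlanarConvex (E : Set Plane) : Prop where
  convex : Convex ℝ E
  isBounded : Bornology.IsBounded E
  nonempty_interior : (interior E).Nonempty

/-- The perimeter of a planar convex set: the length of its boundary. -/
noncomputable def perimeter (E : Set Plane) : ℝ :=
  (Measure.hausdorffMeasure 1 (frontier E)).toReal

/-- The area. -/
noncomputable def area (E : Set Plane) : ℝ := (volume E).toReal

/-- The curvature moment `∫ |x - x₀|² dμ_E(x)`. -/
noncomputable def curvatureMoment (E : Set Plane) (hE : Bornology.IsBounded E) (x₀ : Plane) : ℝ :=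
  ∫ x, ‖x - x₀‖ ^ 2 ∂(curvatureMeasure E hE)

/-! Everything is read off the support function p(θ), which is Lipschitz and 2π-periodic. At almost
every θ it is differentiable, and then p u + p' u' is the only boundary point with outer normal
u(θ). Hence the curvature measure is the image of dθ under this map, and the moment about x₀ is ∫ (p
- ⟨x₀,u⟩)² + (p' - ⟨x₀,u'⟩)² (`curvatureMoment_eq`). Cauchy's formulas give P = ∫ p and 2|E| = ∫ p²
- ∫ p'² (`perimeter_and_area_eq_integral`).

Split p into its mean, its first harmonics and the rest. Let W and D be the squared L² norms of the
rest and of its derivative, and c = (1/π) ∫ p u the Steiner point. Then moment plus 2β|E| equals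
(1+β) P²/(2π) + (1+β) W + (1-β) D + 2π |x₀ - c|² (`curvatureMoment_eq_energies`), and the infimum
over x₀ drops the last square. For β ≤ 1 the remainder is visibly nonnegative. Parseval gives D ≥ 4W
(`four_mul_higherHarmonicEnergy_le`), so for β ≥ 5/3 it is at most (5 - 3β) W ≤ 0. In the strict
ranges equality forces W = 0, which means that E is a disc up to boundary points. Small
perturbations p = 1 + ε cos kθ of the disc have D = k² W: large k shows that 1 is sharp, k = 2 that
5/3 is sharp.

The longest part is Cauchy's formulas without smoothness. Circumscribe about E a polygon Q whose
normals are the angles t + jδ, δ = π/m. Its edge lengths are (p(θ+δ) + p(θ-δ) - 2 cos δ p(θ)) / sin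
δ, its area is half the sum of p times these lengths, and E ⊆ Q ⊆ (1 + Cδ) E for closed E containing
a ball about 0. Perimeter and area are monotone under inclusion of convex sets; averaging over the
rotation t turns the polygon sums into exact integrals, and m → ∞ closes the sandwich. -/

/-! ### Integration over a period and real Fourier coefficients -/

theorem intervalIntegrable_of_bounded {g : ℝ → ℝ} (hg : Measurable g) {C : ℝ}
    (hC : ∀ x, |g x| ≤ C) (a b : ℝ) : IntervalIntegrable g volume a b := by
  refine (intervalIntegrable_const (c := C)).mono_fun hg.aestronglyMeasurable
    (Filter.Eventually.of_forall fun x => ?_)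
  simpa using (hC x).trans (le_abs_self C)

theorem intervalIntegrable_mul_of_bounded {f g : ℝ → ℝ} (hf : Continuous f) (hg : Measurable g)
    {C : ℝ} (hC : ∀ x, |g x| ≤ C) (a b : ℝ) :
    IntervalIntegrable (fun x => f x * g x) volume a b :=
  (intervalIntegrable_of_bounded hg hC a b).continuousOn_mul hf.continuousOn

theorem lipschitz_abs_deriv_le {f : ℝ → ℝ} {K : NNReal} (hf : LipschitzWith K f) (x : ℝ) :
    |deriv f x| ≤ K := by
  simpa using norm_deriv_le_of_lipschitz (x₀ := x) hf

theorem intervalIntegrable_deriv_sq {f : ℝ → ℝ} {K : NNReal} (hf : LipschitzWith K f) (a b : ℝ) :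
    IntervalIntegrable (fun x => deriv f x ^ 2) volume a b := by
  refine intervalIntegrable_of_bounded ((measurable_deriv f).pow_const 2) (C := (K : ℝ) ^ 2)
    (fun x => ?_) a b
  rw [abs_pow]
  exact pow_le_pow_left₀ (abs_nonneg _) (lipschitz_abs_deriv_le hf x) 2

/-- Integration by parts over a period. -/
theorem integral_deriv_mul_periodic {f g : ℝ → ℝ} {K L : NNReal} (hf : LipschitzWith K f)
    (hg : LipschitzWith L g) (hfp : Function.Periodic f (2 * π))
    (hgp : Function.Periodic g (2 * π)) :
    ∫ x in 0..2 * π, deriv f x * g x = -∫ x in 0..2 * π, f x * deriv g x := by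
  have h := AbsolutelyContinuousOnInterval.integral_mul_deriv_eq_deriv_mul
    (hf.lipschitzOnWith (s := uIcc 0 (2 * π))).absolutelyContinuousOnInterval
    (hg.lipschitzOnWith (s := uIcc 0 (2 * π))).absolutelyContinuousOnInterval
  have h1 : f (2 * π) = f 0 := by simpa using hfp 0
  have h2 : g (2 * π) = g 0 := by simpa using hgp 0
  rw [h1, h2] at h
  linarith

theorem hasDerivAt_cos_mul (n x : ℝ) :
    HasDerivAt (fun y => Real.cos (n * y)) (-(n * Real.sin (n * x))) x := by
  have h := (Real.hasDerivAt_cos (n * x)).comp x ((hasDerivAt_id x).const_mul n)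
  refine h.congr_deriv ?_
  ring

theorem hasDerivAt_sin_mul (n x : ℝ) :
    HasDerivAt (fun y => Real.sin (n * y)) (n * Real.cos (n * x)) x := by
  have h := (Real.hasDerivAt_sin (n * x)).comp x ((hasDerivAt_id x).const_mul n)
  refine h.congr_deriv ?_
  ring

theorem lipschitzWith_cos_mul (n : ℝ) : LipschitzWith ‖n‖₊ fun y => Real.cos (n * y) := by
  refine lipschitzWith_of_nnnorm_deriv_le (fun x => (hasDerivAt_cos_mul n x).differentiableAt)
    fun x => ?_
  rw [(hasDerivAt_cos_mul n x).deriv, ← NNReal.coe_le_coe]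
  simp only [coe_nnnorm, norm_neg, norm_mul, Real.norm_eq_abs]
  exact mul_le_of_le_one_right (abs_nonneg _) (Real.abs_sin_le_one _)

theorem lipschitzWith_sin_mul (n : ℝ) : LipschitzWith ‖n‖₊ fun y => Real.sin (n * y) := by
  refine lipschitzWith_of_nnnorm_deriv_le (fun x => (hasDerivAt_sin_mul n x).differentiableAt)
    fun x => ?_
  rw [(hasDerivAt_sin_mul n x).deriv, ← NNReal.coe_le_coe]
  simp only [coe_nnnorm, norm_mul, Real.norm_eq_abs]
  exact mul_le_of_le_one_right (abs_nonneg _) (Real.abs_cos_le_one _)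

theorem periodic_cos_mul (n : ℤ) : Function.Periodic (fun y => Real.cos (n * y)) (2 * π) := by
  intro x
  simp only [mul_add]
  exact Real.cos_add_int_mul_two_pi _ n

theorem periodic_sin_mul (n : ℤ) : Function.Periodic (fun y => Real.sin (n * y)) (2 * π) := by
  intro x
  simp only [mul_add]
  exact Real.sin_add_int_mul_two_pi _ n

theorem integral_deriv_mul_cos {f : ℝ → ℝ} {K : NNReal} (hf : LipschitzWith K f)
    (hfp : Function.Periodic f (2 * π)) (n : ℤ) :
    ∫ x in 0..2 * π, deriv f x * Real.cos (n * x) = n * ∫ x in 0..2 * π, f x * Real.sin (n * x) := by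
  rw [integral_deriv_mul_periodic hf (lipschitzWith_cos_mul n) hfp (periodic_cos_mul n),
    ← intervalIntegral.integral_const_mul, ← intervalIntegral.integral_neg]
  refine intervalIntegral.integral_congr fun x _ => ?_
  simp only [(hasDerivAt_cos_mul n x).deriv]
  ring

theorem integral_deriv_mul_sin {f : ℝ → ℝ} {K : NNReal} (hf : LipschitzWith K f)
    (hfp : Function.Periodic f (2 * π)) (n : ℤ) :
    ∫ x in 0..2 * π, deriv f x * Real.sin (n * x) =
      -(n * ∫ x in 0..2 * π, f x * Real.cos (n * x)) := by
  rw [integral_deriv_mul_periodic hf (lipschitzWith_sin_mul n) hfp (periodic_sin_mul n),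
    ← intervalIntegral.integral_const_mul]
  congr 1
  refine intervalIntegral.integral_congr fun x _ => ?_
  simp only [(hasDerivAt_sin_mul n x).deriv]
  ring

/-- Parseval's identity for the real Fourier coefficients of a bounded function. -/
theorem hasSum_sq_integral_mul_cos_sin {g : ℝ → ℝ} (hg : Measurable g) {C : ℝ}
    (hC : ∀ x, |g x| ≤ C) :
    HasSum (fun n : ℤ => (∫ x in 0..2 * π, g x * Real.cos (n * x)) ^ 2 +
      (∫ x in 0..2 * π, g x * Real.sin (n * x)) ^ 2) (2 * π * ∫ x in 0..2 * π, g x ^ 2) := by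
  have hmem : MemLp (fun x => (g x : ℂ)) 2 (volume.restrict (Ioc 0 (2 * π))) := by
    refine MemLp.of_bound (Complex.measurable_ofReal.comp hg).aestronglyMeasurable C
      (Filter.Eventually.of_forall fun x => ?_)
    simpa using hC x
  -- The complex coefficients carry a factor 1/(2π); its inverse square is put back here.
  have h := (hasSum_sq_fourierCoeffOn Real.two_pi_pos hmem).mul_left ((2 * π) ^ 2)
  have hpi : (2 * π : ℝ) ≠ 0 := Real.two_pi_pos.ne'
  have hc : ∀ n : ℤ, IntervalIntegrable (fun x => g x * Real.cos (n * x)) volume 0 (2 * π) :=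
    fun n => (intervalIntegrable_mul_of_bounded (by fun_prop) hg hC _ _).congr
      fun x _ => mul_comm _ _
  have hs : ∀ n : ℤ, IntervalIntegrable (fun x => g x * Real.sin (n * x)) volume 0 (2 * π) :=
    fun n => (intervalIntegrable_mul_of_bounded (by fun_prop) hg hC _ _).congr
      fun x _ => mul_comm _ _
  convert! h using 1
  · funext n
    have hint : ∫ x in 0..2 * π, fourier (-n) (x : AddCircle (2 * π - 0)) • (g x : ℂ) =
        ((∫ x in 0..2 * π, g x * Real.cos (n * x) : ℝ) : ℂ) -
          ((∫ x in 0..2 * π, g x * Real.sin (n * x) : ℝ) : ℂ) * Complex.I := by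
      rw [← intervalIntegral.integral_ofReal, ← intervalIntegral.integral_ofReal,
        ← intervalIntegral.integral_mul_const, ← intervalIntegral.integral_sub]
      · refine intervalIntegral.integral_congr fun x _ => ?_
        have harg : 2 * π * Complex.I * ((-n : ℤ) : ℂ) * x / ((2 * π - 0 : ℝ) : ℂ) =
            -(((n * x : ℝ) : ℂ) * Complex.I) := by
          have : (π : ℂ) ≠ 0 := Complex.ofReal_ne_zero.2 Real.pi_ne_zero
          push_cast
          field_simp
          ring
        simp only [fourier_coe_apply, harg, smul_eq_mul]
        rw [← neg_mul, Complex.exp_mul_I, Complex.cos_neg, Complex.sin_neg]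
        push_cast
        ring
      · exact ⟨(hc n).1.ofReal, (hc n).2.ofReal⟩
      · exact IntervalIntegrable.mul_const ⟨(hs n).1.ofReal, (hs n).2.ofReal⟩ _
    rw [fourierCoeffOn_eq_integral, hint, norm_smul, mul_pow ‖_‖, ← Complex.normSq_eq_norm_sq]
    have hre : ∀ a b : ℝ, Complex.normSq ((a : ℂ) - b * Complex.I) = a ^ 2 + b ^ 2 := by
      intro a b
      rw [Complex.normSq_apply]
      simp
      ring
    rw [hre, sub_zero, Real.norm_eq_abs, sq_abs]
    field_simp
  · simp only [Complex.norm_real, Real.norm_eq_abs, sq_abs, sub_zero, smul_eq_mul]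
    field_simp

/-- A Wirtinger inequality. Differentiation multiplies the energy at frequency n by n², and n² ≥ 4
unless n is 0 or ±1. Those three frequencies are paid for by explicit corrections 4 - n², that is 4
at n = 0 and 3 at each of n = ±1, whence the constant 6. -/
theorem four_mul_integral_sq_le {f : ℝ → ℝ} {K : NNReal} (hf : LipschitzWith K f)
    (hfp : Function.Periodic f (2 * π)) :
    4 * (2 * π * ∫ x in 0..2 * π, f x ^ 2) ≤ 2 * π * (∫ x in 0..2 * π, deriv f x ^ 2) +
      (4 * (∫ x in 0..2 * π, f x) ^ 2 + 6 * ((∫ x in 0..2 * π, f x * Real.cos x) ^ 2 +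
        (∫ x in 0..2 * π, f x * Real.sin x) ^ 2)) := by
  obtain ⟨C, hC⟩ : ∃ C, ∀ x, |f x| ≤ C := by
    obtain ⟨C, hC⟩ := (isCompact_Icc (a := 0) (b := 2 * π)).exists_bound_of_continuousOn
      hf.continuous.continuousOn
    refine ⟨C, fun x => ?_⟩
    obtain ⟨y, hy, hxy⟩ := hfp.exists_mem_Ico₀ Real.two_pi_pos x
    rw [hxy]
    exact hC y (Ico_subset_Icc_self hy)
  have h0 := (hasSum_sq_integral_mul_cos_sin hf.continuous.measurable hC).mul_left 4
  have h1 := hasSum_sq_integral_mul_cos_sin (measurable_deriv f) (lipschitz_abs_deriv_le hf)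
  set Z : ℤ → ℝ := fun n => (∫ x in 0..2 * π, f x * Real.cos (n * x)) ^ 2 +
      (∫ x in 0..2 * π, f x * Real.sin (n * x)) ^ 2 with hZ
  have hZ0 : ∀ n, 0 ≤ Z n := fun n => by positivity
  have hsum := hasSum_sum_of_ne_finset_zero (L := SummationFilter.unconditional ℤ) (s := {-1, 0, 1})
    (f := fun n : ℤ => if n ∈ ({-1, 0, 1} : Finset ℤ) then (4 - (n : ℝ) ^ 2) * Z n else 0)
    (fun n hn => if_neg hn)
  have hle := hasSum_le (fun n => ?_) h0 (h1.add hsum)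
  · refine hle.trans (le_of_eq ?_)
    congr 1
    simp [hZ, Finset.sum_insert]
    ring
  · have hZ' : (∫ x in 0..2 * π, deriv f x * Real.cos (n * x)) ^ 2 +
      (∫ x in 0..2 * π, deriv f x * Real.sin (n * x)) ^ 2 = (n : ℝ) ^ 2 * Z n := by
      rw [integral_deriv_mul_cos hf hfp, integral_deriv_mul_sin hf hfp, hZ]
      ring
    change 4 * Z n ≤ _
    rw [hZ']
    split_ifs with h
    · linarith
    · have : (4 : ℝ) ≤ (n : ℝ) ^ 2 := by
        have h4 : (4 : ℤ) ≤ n ^ 2 := by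
          simp at h
          rcases lt_or_ge n 0 with h' | h'
          · have : n ≤ -2 := by omega
            nlinarith
          · have : 2 ≤ n := by omega
            nlinarith
        exact_mod_cast h4
      rw [add_zero]
      exact mul_le_mul_of_nonneg_right this (hZ0 n)

theorem integral_cos_sq_period : ∫ x in 0..2 * π, Real.cos x ^ 2 = π := by
  rw [integral_cos_sq]; simp

theorem integral_sin_sq_period : ∫ x in 0..2 * π, Real.sin x ^ 2 = π := by
  rw [integral_sin_sq]; simp

theorem integral_cos_period : ∫ x in 0..2 * π, Real.cos x = 0 := by
  rw [integral_cos]; simp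

theorem integral_sin_period : ∫ x in 0..2 * π, Real.sin x = 0 := by
  rw [integral_sin]; simp

theorem integral_cos_mul_sin_period : ∫ x in 0..2 * π, Real.cos x * Real.sin x = 0 := by
  have h : ∀ x, Real.cos x * Real.sin x = Real.sin x * Real.cos x := fun x => mul_comm _ _
  simp_rw [h]
  rw [integral_sin_mul_cos₁]
  simp

/-- Expansion of the square of a perturbation by first harmonics. -/
theorem integral_sq_sub_harmonic {f : ℝ → ℝ} (hf : IntervalIntegrable f volume 0 (2 * π))
    (hf2 : IntervalIntegrable (fun x => f x ^ 2) volume 0 (2 * π)) (m a b : ℝ) :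
    ∫ x in 0..2 * π, (f x - (m + (a * Real.cos x + b * Real.sin x))) ^ 2 =
      (∫ x in 0..2 * π, f x ^ 2) - 2 * m * (∫ x in 0..2 * π, f x) + 2 * π * m ^ 2
        - 2 * (a * (∫ x in 0..2 * π, f x * Real.cos x) + b * ∫ x in 0..2 * π, f x * Real.sin x)
        + π * (a ^ 2 + b ^ 2) := by
  have hc := hf.mul_continuousOn (Real.continuous_cos.continuousOn)
  have hs := hf.mul_continuousOn (Real.continuous_sin.continuousOn)
  have hT : ∀ {g : ℝ → ℝ}, Continuous g → IntervalIntegrable g volume 0 (2 * π) :=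
    fun hg => hg.intervalIntegrable _ _
  have e : ∀ x, (f x - (m + (a * Real.cos x + b * Real.sin x))) ^ 2 =
      ((((f x ^ 2 + (-2 * m) * f x) + (-2 * a) * (f x * Real.cos x)) +
        (-2 * b) * (f x * Real.sin x)) + m ^ 2) + (((a ^ 2 * Real.cos x ^ 2 +
        b ^ 2 * Real.sin x ^ 2) + (2 * a * b) * (Real.cos x * Real.sin x)) +
        ((2 * m * a) * Real.cos x + (2 * m * b) * Real.sin x)) := fun x => by ring
  simp_rw [e]
  have i1 := hf2.add (hf.const_mul (-2 * m))
  have i2 := i1.add (hc.const_mul (-2 * a))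
  have i3 := i2.add (hs.const_mul (-2 * b))
  have i4 := i3.add (intervalIntegrable_const (c := m ^ 2))
  rw [intervalIntegral.integral_add i4 (hT (by fun_prop)),
    intervalIntegral.integral_add i3 intervalIntegrable_const,
    intervalIntegral.integral_add i2 (hs.const_mul _),
    intervalIntegral.integral_add i1 (hc.const_mul _),
    intervalIntegral.integral_add hf2 (hf.const_mul _),
    intervalIntegral.integral_add (hT (by fun_prop)) (hT (by fun_prop)),
    intervalIntegral.integral_add (hT (by fun_prop)) (hT (by fun_prop)),
    intervalIntegral.integral_add (hT (by fun_prop)) (hT (by fun_prop)),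
    intervalIntegral.integral_add (hT (by fun_prop)) (hT (by fun_prop))]
  simp only [intervalIntegral.integral_const_mul, integral_cos_sq_period, integral_sin_sq_period,
    integral_cos_period, integral_sin_period, integral_cos_mul_sin_period,
    intervalIntegral.integral_const, smul_eq_mul]
  ring

section

variable {f : ℝ → ℝ} {K : NNReal}

theorem integral_sq_sub_harmonic_of_continuous (hf : Continuous f) (m a b : ℝ) :
    ∫ x in 0..2 * π, (f x - (m + (a * Real.cos x + b * Real.sin x))) ^ 2 =
      (∫ x in 0..2 * π, f x ^ 2) - 2 * m * (∫ x in 0..2 * π, f x) + 2 * π * m ^ 2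
        - 2 * (a * (∫ x in 0..2 * π, f x * Real.cos x) + b * ∫ x in 0..2 * π, f x * Real.sin x)
        + π * (a ^ 2 + b ^ 2) :=
  integral_sq_sub_harmonic (hf.intervalIntegrable _ _) ((hf.pow 2).intervalIntegrable _ _) m a b

/-- Integration by parts expresses the first harmonic coefficients of f' by those of f, so the
linear term is the same as in the expansion for f itself. -/
theorem integral_deriv_sq_sub_harmonic (hf : LipschitzWith K f)
    (hfp : Function.Periodic f (2 * π)) (a b : ℝ) :
    ∫ x in 0..2 * π, (deriv f x - (-a * Real.sin x + b * Real.cos x)) ^ 2 =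
      (∫ x in 0..2 * π, deriv f x ^ 2)
        - 2 * (a * (∫ x in 0..2 * π, f x * Real.cos x) + b * ∫ x in 0..2 * π, f x * Real.sin x)
        + π * (a ^ 2 + b ^ 2) := by
  have h := integral_sq_sub_harmonic (f := deriv f)
    (intervalIntegrable_of_bounded (measurable_deriv f) (lipschitz_abs_deriv_le hf) _ _)
    (intervalIntegrable_deriv_sq hf _ _) 0 b (-a)
  have hc := integral_deriv_mul_cos hf hfp 1
  have hs := integral_deriv_mul_sin hf hfp 1
  simp only [Int.cast_one, one_mul] at hc hs
  rw [hc, hs] at h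
  calc _ = ∫ x in 0..2 * π, (deriv f x - (0 + (b * Real.cos x + -a * Real.sin x))) ^ 2 := by
        refine intervalIntegral.integral_congr fun x _ => ?_
        ring
    _ = _ := by rw [h]; ring

theorem lipschitzWith_sub_harmonic (hf : LipschitzWith K f) (a b : ℝ) :
    ∃ L, LipschitzWith L fun x => f x - (a * Real.cos x + b * Real.sin x) := by
  have h1 := (lipschitzWith_smul a).comp Real.lipschitzWith_cos
  have h2 := (lipschitzWith_smul b).comp Real.lipschitzWith_sin
  exact ⟨_, hf.sub (h1.add h2)⟩

theorem hasDerivAt_sub_harmonic {x : ℝ} (hf : DifferentiableAt ℝ f x) (a b : ℝ) :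
    HasDerivAt (fun x => f x - (a * Real.cos x + b * Real.sin x))
      (deriv f x - (-a * Real.sin x + b * Real.cos x)) x := by
  refine (hf.hasDerivAt.sub (((Real.hasDerivAt_cos x).const_mul a).add
    ((Real.hasDerivAt_sin x).const_mul b))).congr_deriv ?_
  ring

theorem integral_sq_deriv_sub_harmonic (hf : LipschitzWith K f)
    (hfp : Function.Periodic f (2 * π)) (a b : ℝ) :
    ∫ x in 0..2 * π, deriv (fun x => f x - (a * Real.cos x + b * Real.sin x)) x ^ 2 =
      (∫ x in 0..2 * π, deriv f x ^ 2)
        - 2 * (a * (∫ x in 0..2 * π, f x * Real.cos x) + b * ∫ x in 0..2 * π, f x * Real.sin x)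
        + π * (a ^ 2 + b ^ 2) := by
  rw [← integral_deriv_sq_sub_harmonic hf hfp a b]
  refine intervalIntegral.integral_congr_ae ?_
  filter_upwards [hf.ae_differentiableAt_real] with x hx _
  rw [(hasDerivAt_sub_harmonic hx a b).deriv]

/-- A periodic continuous function whose square has zero integral over a period vanishes. -/
theorem eq_zero_of_integral_sq_eq_zero {g : ℝ → ℝ} (hg : Continuous g)
    (hgp : Function.Periodic g (2 * π)) (h : ∫ x in 0..2 * π, g x ^ 2 = 0) (x : ℝ) : g x = 0 := by
  obtain ⟨y, hy, hxy⟩ := hgp.exists_mem_Ico₀ Real.two_pi_pos x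
  rw [hxy]
  by_contra hne
  have := intervalIntegral.integral_pos (f := fun x => g x ^ 2) Real.two_pi_pos
    (hg.pow 2).continuousOn (fun x _ => sq_nonneg _) ⟨y, Ico_subset_Icc_self hy, by positivity⟩
  linarith

end

/-! ### The support function and the curvature measure -/

theorem unitVec_periodic : Function.Periodic unitVec (2 * π) := fun θ => by
  simp [unitVec]

theorem supportAngle_periodic (E : Set Plane) : Function.Periodic (supportAngle E) (2 * π) :=
  fun θ => by simp only [supportAngle, unitVec_periodic θ]

theorem exists_eq_norm_smul_unitVec (v : Plane) : ∃ θ, v = ‖v‖ • unitVec θ := by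
  refine ⟨Complex.arg ⟨v 0, v 1⟩, ?_⟩
  have hn : ‖(⟨v 0, v 1⟩ : ℂ)‖ = ‖v‖ := by
    rw [EuclideanSpace.norm_eq, Complex.norm_eq_sqrt_sq_add_sq]
    simp [Fin.sum_univ_two]
  have h0 := Complex.norm_mul_cos_arg ⟨v 0, v 1⟩
  have h1 := Complex.norm_mul_sin_arg ⟨v 0, v 1⟩
  rw [hn] at h0 h1
  ext i
  fin_cases i
  · simpa [unitVec] using h0.symm
  · simpa [unitVec] using h1.symm

section

variable {E : Set Plane}

theorem supportAngle_le (hne : E.Nonempty) {θ c : ℝ}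
    (h : ∀ y ∈ E, inner ℝ y (unitVec θ) ≤ c) : supportAngle E θ ≤ c :=
  csSup_le (hne.image _) (by rintro _ ⟨y, hy, rfl⟩; exact h y hy)

theorem supportAngle_closure (hE : Bornology.IsBounded E) (hne : E.Nonempty) :
    supportAngle (closure E) = supportAngle E := by
  funext θ
  refine le_antisymm (supportAngle_le hne.closure fun y hy => inner_le_supportAngle hE hy θ)
    (supportAngle_le hne fun y hy => inner_le_supportAngle hE.closure ?_ θ)
  exact subset_closure (subset_closure hy)

theorem exists_mem_closure_inner_eq_supportAngle (hE : Bornology.IsBounded E) (hne : E.Nonempty)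
    (θ : ℝ) : ∃ x ∈ closure E, inner ℝ x (unitVec θ) = supportAngle E θ := by
  have hc : IsCompact (closure E) := hE.isCompact_closure
  obtain ⟨x, hx, hmax⟩ := hc.exists_isMaxOn hne.closure
    (f := fun x => inner ℝ x (unitVec θ)) (by fun_prop)
  refine ⟨x, hx, le_antisymm (inner_le_supportAngle hE hx θ) (supportAngle_le hne fun y hy => ?_)⟩
  exact hmax (subset_closure hy)

theorem inner_lt_of_mem_interior {x : Plane} {θ c : ℝ}
    (h : ∀ y ∈ E, inner ℝ y (unitVec θ) ≤ c) (hx : x ∈ interior E) :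
    inner ℝ x (unitVec θ) < c := by
  obtain ⟨ε, hε, hb⟩ := Metric.isOpen_iff.1 isOpen_interior x hx
  have hm : x + (ε / 2) • unitVec θ ∈ E := interior_subset (hb (by
    simp [norm_smul, norm_unitVec, abs_of_pos hε, hε]))
  have h := h _ hm
  rw [inner_add_left, real_inner_smul_left, real_inner_self_eq_norm_sq, norm_unitVec] at h
  linarith

theorem inner_lt_supportAngle_of_mem_interior (hE : Bornology.IsBounded E) {x : Plane}
    (hx : x ∈ interior E) (θ : ℝ) : inner ℝ x (unitVec θ) < supportAngle E θ :=
  inner_lt_of_mem_interior (fun _ hy => inner_le_supportAngle hE (subset_closure hy) θ) hx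

/-- If x is outside the closure, a separating functional is the inner product with a nonzero vector;
the direction of that vector is an angle at which the inequality fails. -/
theorem mem_closure_iff_inner_le_supportAngle (hE : Bornology.IsBounded E) (hc : Convex ℝ E)
    (hne : E.Nonempty) {x : Plane} :
    x ∈ closure E ↔ ∀ θ, inner ℝ x (unitVec θ) ≤ supportAngle E θ := by
  refine ⟨fun hx θ => inner_le_supportAngle hE hx θ, fun h => ?_⟩
  by_contra hx
  obtain ⟨f, c, hfc, hcx⟩ := geometric_hahn_banach_closed_point hc.closure isClosed_closure hx
  obtain ⟨v, rfl⟩ := (InnerProductSpace.toDual ℝ Plane).surjective f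
  simp only [InnerProductSpace.toDual_apply_apply] at hfc hcx
  obtain ⟨θ, hθ⟩ := exists_eq_norm_smul_unitVec v
  have hv : 0 < ‖v‖ := by
    refine norm_pos_iff.2 fun h0 => ?_
    obtain ⟨y, hy⟩ := hne
    have := (hfc y (subset_closure hy)).trans hcx
    simp [h0] at this
  obtain ⟨y, hy, hyθ⟩ := exists_mem_closure_inner_eq_supportAngle hE hne θ
  have h1 := (hfc y hy).trans hcx
  rw [hθ, real_inner_smul_left, real_inner_smul_left, real_inner_comm, real_inner_comm x, hyθ] at h1
  exact (lt_of_mul_lt_mul_left h1 hv.le).not_ge (h θ)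

/-- A maximiser of the inner product with the unit vector over the closure cannot be interior, so
every unit vector is an outer normal somewhere on the frontier. Where the support function is
differentiable, that point must be the value of `reverseGauss`. -/
theorem ae_reverseGauss_mem_frontier (hE : Bornology.IsBounded E) (hne : E.Nonempty) :
    ∀ᵐ θ, reverseGauss E θ ∈ frontier E := by
  obtain ⟨K, hK⟩ := supportAngle_lipschitz hE
  filter_upwards [hK.ae_differentiableAt_real] with θ hθ
  have h : unitVec θ ∈ sphericalImage E univ := by
    obtain ⟨x, hx, hxθ⟩ := exists_mem_closure_inner_eq_supportAngle hE hne θ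
    refine ⟨norm_unitVec θ, x, ⟨mem_univ x, hx, fun hi => ?_⟩, fun y hy => ?_⟩
    · exact (inner_lt_supportAngle_of_mem_interior hE hi θ).ne hxθ
    · rw [inner_sub_left, hxθ]
      linarith [inner_le_supportAngle hE (subset_closure hy) θ]
  exact ((mem_sphericalImage_iff hE univ hθ).1 h).2

theorem curvatureMeasure_eq_map (hE : Bornology.IsBounded E) (hne : E.Nonempty) :
    curvatureMeasure E hE = (volume.restrict (Ico 0 (2 * π))).map (reverseGauss E) := by
  have h : ((volume.restrict (Ico 0 (2 * π))).map (reverseGauss E)).restrict (frontier E) =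
      (volume.restrict (Ico 0 (2 * π))).map (reverseGauss E) := by
    refine Measure.restrict_eq_self_of_ae_mem ?_
    exact (ae_map_iff (measurable_reverseGauss hE).aemeasurable (p := fun x => x ∈ frontier E)
      isClosed_frontier.measurableSet).2 (ae_restrict_of_ae (ae_reverseGauss_mem_frontier hE hne))
  rw [← h]
  ext B hB
  rw [curvatureMeasure, Measure.ofMeasurable_apply B hB, arcLength_sphericalImage hE hB]

/-- Pythagoras in the rotating frame u(θ), u'(θ). The summand `0 +` gives the first square the shape
of `integral_sq_sub_harmonic`. -/
theorem norm_reverseGauss_sub_sq (x₀ : Plane) (θ : ℝ) :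
    ‖reverseGauss E θ - x₀‖ ^ 2 =
      (supportAngle E θ - (0 + (x₀ 0 * Real.cos θ + x₀ 1 * Real.sin θ))) ^ 2 +
      (deriv (supportAngle E) θ - (-x₀ 0 * Real.sin θ + x₀ 1 * Real.cos θ)) ^ 2 := by
  rw [EuclideanSpace.norm_sq_eq]
  simp only [Fin.sum_univ_two, PiLp.sub_apply, Real.norm_eq_abs, sq_abs, reverseGauss]
  simp
  have h := Real.sin_sq_add_cos_sq θ
  linear_combination (supportAngle E θ ^ 2 + deriv (supportAngle E) θ ^ 2 - x₀ 0 ^ 2 -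
    x₀ 1 ^ 2) * h

/-- The two squares contribute the same linear and quadratic terms in x₀, hence the factors 4 and 2π
in place of 2 and π. -/
theorem curvatureMoment_eq (hE : Bornology.IsBounded E) (hne : E.Nonempty) (x₀ : Plane) :
    curvatureMoment E hE x₀ =
      (∫ θ in 0..2 * π, supportAngle E θ ^ 2) + (∫ θ in 0..2 * π, deriv (supportAngle E) θ ^ 2)
      - 4 * (x₀ 0 * (∫ θ in 0..2 * π, supportAngle E θ * Real.cos θ)
        + x₀ 1 * ∫ θ in 0..2 * π, supportAngle E θ * Real.sin θ)
      + 2 * π * (x₀ 0 ^ 2 + x₀ 1 ^ 2) := by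
  obtain ⟨K, hK⟩ := supportAngle_lipschitz hE
  have hp := supportAngle_periodic E
  have e : curvatureMoment E hE x₀ = ∫ θ in 0..2 * π, ‖reverseGauss E θ - x₀‖ ^ 2 := by
    rw [curvatureMoment, curvatureMeasure_eq_map hE hne,
      integral_map (measurable_reverseGauss hE).aemeasurable
        (Continuous.aestronglyMeasurable (by fun_prop)),
      integral_Ico_eq_integral_Ioc, intervalIntegral.integral_of_le Real.two_pi_pos.le]
  simp_rw [e, norm_reverseGauss_sub_sq]
  rw [intervalIntegral.integral_add, integral_sq_sub_harmonic_of_continuous hK.continuous,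
    integral_deriv_sq_sub_harmonic hK hp]
  · ring
  · exact Continuous.intervalIntegrable (by have := hK.continuous; fun_prop) _ _
  · obtain ⟨L, hL⟩ := lipschitzWith_sub_harmonic hK (x₀ 0) (x₀ 1)
    refine (intervalIntegrable_deriv_sq hL 0 (2 * π)).congr_ae ?_
    refine ae_restrict_of_ae ?_
    filter_upwards [hK.ae_differentiableAt_real] with x hx
    rw [(hasDerivAt_sub_harmonic hx _ _).deriv]

end

/-! ### Monotonicity of the perimeter -/

/-- The hypotheses add up to ‖x - x'‖² ≤ ⟨z - z', x - x'⟩, and Cauchy–Schwarz finishes. This serves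
twice: nearest-point projection is 1-Lipschitz, and with z = z' the projection is unique. -/
theorem norm_sub_le_of_inner_le_zero {x x' z z' : Plane} (h : inner ℝ (z - x) (x' - x) ≤ 0)
    (h' : inner ℝ (z' - x') (x - x') ≤ 0) : ‖x - x'‖ ≤ ‖z - z'‖ := by
  have e : inner ℝ (z - x) (x' - x) + inner ℝ (z' - x') (x - x') =
      ‖x - x'‖ ^ 2 - inner ℝ (z - z') (x - x') := by
    have : z - z' = (z - x) - (z' - x') + (x - x') := by abel
    rw [this, inner_add_left, inner_sub_left (z - x) (z' - x'), real_inner_self_eq_norm_sq,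
      ← neg_sub x x', inner_neg_right]
    ring
  have hcs := real_inner_le_norm (z - z') (x - x')
  by_contra! hlt
  have h0 : 0 < ‖x - x'‖ := (norm_nonneg _).trans_lt hlt
  nlinarith

/-- Hahn–Banach separates x from the open set `interior K`; the weak inequality passes to K because
K lies in the closure of its interior. -/
theorem exists_normal_of_mem_frontier {K : Set Plane} (hK : Convex ℝ K)
    (hi : (interior K).Nonempty) {x : Plane} (hx : x ∈ frontier K) :
    ∃ u : Plane, u ≠ 0 ∧ ∀ y ∈ K, inner ℝ (y - x) u ≤ 0 := by
  obtain ⟨f, hf⟩ := geometric_hahn_banach_open_point hK.interior isOpen_interior hx.2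
  obtain ⟨v, rfl⟩ := (InnerProductSpace.toDual ℝ Plane).surjective f
  simp only [InnerProductSpace.toDual_apply_apply] at hf
  refine ⟨v, ?_, fun y hy => ?_⟩
  · rintro rfl
    obtain ⟨y, hy⟩ := hi
    simpa using hf y hy
  · have hcl : y ∈ closure (interior K) := by
      rw [hK.closure_interior_eq_closure_of_nonempty_interior hi]
      exact subset_closure hy
    have hc : IsClosed {y : Plane | inner ℝ v y ≤ inner ℝ v x} :=
      isClosed_le (by fun_prop) continuous_const
    have := closure_minimal (fun y hy => (hf y hy).le) hc hcl
    rw [inner_sub_left, real_inner_comm, real_inner_comm v x]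
    exact sub_nonpos.2 this

theorem inter_frontier_nonempty_of_isPreconnected {X : Type*} [TopologicalSpace X] {s t : Set X}
    (ht : IsPreconnected t) (h1 : (t ∩ s).Nonempty) (h2 : (t ∩ sᶜ).Nonempty) :
    (t ∩ frontier s).Nonempty := by
  by_contra hne
  rw [not_nonempty_iff_eq_empty, ← disjoint_iff_inter_eq_empty, disjoint_left] at hne
  obtain ⟨a, hat, has⟩ := h1
  obtain ⟨b, hbt, hbs⟩ := h2
  have ha : a ∈ interior s := by
    by_contra hi
    exact hne hat ⟨subset_closure has, hi⟩
  have hb : b ∈ (closure s)ᶜ := fun hi => hne hbt ⟨hi, fun h => hbs (interior_subset h)⟩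
  obtain ⟨c, -, hc, hc'⟩ := ht _ _ isOpen_interior isClosed_closure.isOpen_compl (fun x hx => by
    by_contra hx'
    rw [mem_union, not_or, notMem_compl_iff] at hx'
    exact hne hx ⟨hx'.2, hx'.1⟩) ⟨a, hat, ha⟩ ⟨b, hbt, hb⟩
  exact hc' (subset_closure (interior_subset hc))

/-- Nearest-point projection onto K is 1-Lipschitz, so it does not increase length, and it maps the
frontier of L over that of K: the outer normal ray at a frontier point x of K meets the frontier of
L, and all points of that ray project to x. -/
theorem hausdorffMeasure_frontier_mono {K L : Set Plane} (hK : Convex ℝ K) (hKc : IsClosed K)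
    (hi : (interior K).Nonempty) (hL : Bornology.IsBounded L) (hKL : K ⊆ L) :
    Measure.hausdorffMeasure 1 (frontier K) ≤ Measure.hausdorffMeasure 1 (frontier L) := by
  have hne : K.Nonempty := hi.mono interior_subset
  have hproj : ∀ z : Plane, ∃ x ∈ K, ∀ y ∈ K, inner ℝ (z - x) (y - x) ≤ 0 := fun z => by
    obtain ⟨x, hx, hxz⟩ := exists_norm_eq_iInf_of_complete_convex hne hKc.isComplete hK z
    exact ⟨x, hx, (norm_eq_iInf_iff_real_inner_le_zero hK hx).1 hxz⟩
  choose f hfK hf using hproj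
  have hlip : LipschitzWith 1 f := LipschitzWith.of_dist_le_mul fun z z' => by
    rw [dist_eq_norm, dist_eq_norm, NNReal.coe_one, one_mul]
    exact norm_sub_le_of_inner_le_zero (hf z _ (hfK z')) (hf z' _ (hfK z))
  have hsub : frontier K ⊆ f '' frontier L := by
    intro x hx
    have hxK : x ∈ K := hKc.frontier_subset hx
    obtain ⟨u, hu, hxu⟩ := exists_normal_of_mem_frontier hK hi hx
    -- The normal ray is connected, starts in L and leaves it because L is bounded.
    have hpre : IsPreconnected ((fun T : ℝ => x + T • u) '' Ici 0) :=
      isPreconnected_Ici.image _ (by fun_prop)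
    obtain ⟨_, ⟨T, hT, rfl⟩, hz⟩ := inter_frontier_nonempty_of_isPreconnected (s := L)
      hpre ⟨x, ⟨0, by simp, by simp⟩, hKL hxK⟩ (by
        obtain ⟨R, hR⟩ := hL.exists_norm_le
        have hu' : 0 < ‖u‖ := norm_pos_iff.2 hu
        refine ⟨_, ⟨(|R| + ‖x‖ + 1) / ‖u‖, mem_Ici.2 (by positivity), rfl⟩, fun hmem => ?_⟩
        have h1 := hR _ hmem
        have h2 : ‖((|R| + ‖x‖ + 1) / ‖u‖) • u‖ = |R| + ‖x‖ + 1 := by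
          rw [norm_smul, Real.norm_of_nonneg (by positivity)]
          field_simp
        have h3 := norm_sub_le (x + ((|R| + ‖x‖ + 1) / ‖u‖) • u) x
        rw [add_sub_cancel_left, h2] at h3
        linarith [le_abs_self R])
    refine ⟨_, hz, ?_⟩
    have h1 : inner ℝ (x + T • u - x) (f (x + T • u) - x) ≤ 0 := by
      rw [add_sub_cancel_left, real_inner_smul_left, real_inner_comm]
      exact mul_nonpos_of_nonneg_of_nonpos hT (hxu _ (hfK _))
    have h2 := norm_sub_le_of_inner_le_zero h1 (hf (x + T • u) x hxK)
    rw [sub_self, norm_zero] at h2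
    exact (sub_eq_zero.1 (norm_le_zero_iff.1 h2)).symm
  calc Measure.hausdorffMeasure 1 (frontier K)
      ≤ Measure.hausdorffMeasure 1 (f '' frontier L) := measure_mono hsub
    _ ≤ (1 : NNReal) ^ (1 : ℝ) * Measure.hausdorffMeasure 1 (frontier L) :=
        hlip.hausdorffMeasure_image_le zero_le_one _
    _ = _ := by simp

/-! ### Circumscribed equiangular polygons -/

theorem inner_frame (s y θ φ : ℝ) :
    inner ℝ (s • unitVec θ + y • unitVec (θ + π / 2)) (unitVec φ) =
      s * Real.cos (φ - θ) + y * Real.sin (φ - θ) := by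
  rw [inner_unitVec, Real.cos_sub, Real.sin_sub]
  simp [unitVec, Real.cos_add_pi_div_two, Real.sin_add_pi_div_two]
  ring

theorem frame_repr (x : Plane) (θ : ℝ) :
    x = inner ℝ x (unitVec θ) • unitVec θ +
      inner ℝ x (unitVec (θ + π / 2)) • unitVec (θ + π / 2) := by
  have h := Real.sin_sq_add_cos_sq θ
  ext i
  simp only [inner_unitVec, Real.cos_add_pi_div_two, Real.sin_add_pi_div_two]
  fin_cases i
  · simp [unitVec, Real.cos_add_pi_div_two, Real.sin_add_pi_div_two]
    linear_combination -(x 0) * h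
  · simp [unitVec, Real.cos_add_pi_div_two, Real.sin_add_pi_div_two]
    linear_combination -(x 1) * h

theorem inner_unitVec_eq (x : Plane) (θ φ : ℝ) :
    inner ℝ x (unitVec φ) = inner ℝ x (unitVec θ) * Real.cos (φ - θ) +
      inner ℝ x (unitVec (θ + π / 2)) * Real.sin (φ - θ) := by
  conv_lhs => rw [frame_repr x θ]
  exact inner_frame _ _ _ _

/-- The vectors satisfy sin δ u(φ) = sin(φ-θ) u(θ+δ) - sin(φ-θ-δ) u(θ). Test this at a point
supporting E in direction θ+δ or θ, whichever leaves the other support value with a coefficient of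
the favourable sign. In the excluded case both coefficients are positive, as for φ strictly between
θ and θ+δ, and subadditivity gives the reverse inequality. -/
theorem supportAngle_three_term {E : Set Plane} (hE : Bornology.IsBounded E) (hne : E.Nonempty)
    {θ φ δ : ℝ} (hδ : 0 ≤ Real.sin δ)
    (h : ¬(0 < Real.sin (φ - θ) ∧ Real.sin (φ - θ - δ) < 0)) :
    Real.sin (φ - θ) * supportAngle E (θ + δ) - Real.sin (φ - θ - δ) * supportAngle E θ ≤
      Real.sin δ * supportAngle E φ := by
  have key : ∀ x : Plane, Real.sin δ * inner ℝ x (unitVec φ) =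
      Real.sin (φ - θ) * inner ℝ x (unitVec (θ + δ)) -
        Real.sin (φ - θ - δ) * inner ℝ x (unitVec θ) := fun x => by
    rw [inner_unitVec_eq x θ φ, inner_unitVec_eq x θ (θ + δ), Real.sin_sub (φ - θ) δ,
      add_sub_cancel_left]
    ring
  obtain ⟨x, hx, hxe⟩ := exists_mem_closure_inner_eq_supportAngle hE hne (θ + δ)
  obtain ⟨x', hx', hxe'⟩ := exists_mem_closure_inner_eq_supportAngle hE hne θ
  have k := key x
  have k' := key x'
  have a1 := mul_le_mul_of_nonneg_left (inner_le_supportAngle hE hx φ) hδ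
  have a2 := mul_le_mul_of_nonneg_left (inner_le_supportAngle hE hx' φ) hδ
  have b1 := inner_le_supportAngle hE hx θ
  have b2 := inner_le_supportAngle hE hx' (θ + δ)
  rw [hxe] at k
  rw [hxe'] at k'
  rcases le_or_gt 0 (Real.sin (φ - θ - δ)) with h1 | h1
  · have := mul_le_mul_of_nonneg_left b1 h1
    linarith
  · have h2 : Real.sin (φ - θ) ≤ 0 := by
      by_contra! h2
      exact h ⟨h2, h1⟩
    have := mul_le_mul_of_nonpos_left b2 h2
    linarith

theorem exists_lt_two_mul_angle_eq {m : ℕ} (hm : 0 < m) (t : ℝ) (j : ℤ) :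
    ∃ i ∈ Finset.range (2 * m), ∃ q : ℤ,
      t + j * (π / m) = t + (i : ℕ) * (π / m) + q * (2 * π) := by
  have hm' : (0 : ℤ) < 2 * m := by omega
  refine ⟨(j % (2 * m)).toNat, ?_, j / (2 * m), ?_⟩
  · have := Int.emod_lt_of_pos j hm'
    have := Int.emod_nonneg j hm'.ne'
    rw [Finset.mem_range]
    omega
  · have h1 : (((j % (2 * m)).toNat : ℕ) : ℝ) = ((j % (2 * m) : ℤ) : ℝ) := by
      have := Int.toNat_of_nonneg (Int.emod_nonneg j hm'.ne')
      exact_mod_cast congrArg (Int.cast : ℤ → ℝ) this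
    have h2 : (j : ℝ) = ((j % (2 * m) : ℤ) : ℝ) + 2 * m * ((j / (2 * m) : ℤ) : ℝ) := by
      exact_mod_cast (Int.emod_add_mul_ediv j (2 * m)).symm
    have hm0 : (m : ℝ) ≠ 0 := by positivity
    rw [h1, h2]
    field_simp
    ring

/-- The zeros of the sine are themselves multiples of π/m, so consecutive multiples never have sines
of strictly opposite signs. This discharges the exclusion in `supportAngle_three_term` for grid
angles. -/
theorem not_sin_pos_and_sin_neg {m : ℕ} (hm : 0 < m) (k : ℤ) :
    ¬(0 < Real.sin ((k + 1) * (π / m)) ∧ Real.sin (k * (π / m)) < 0) := by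
  rintro ⟨h1, h2⟩
  obtain ⟨i, hi, q, hq⟩ := exists_lt_two_mul_angle_eq hm 0 k
  rw [zero_add, zero_add] at hq
  have hm0 : (0 : ℝ) < m := by positivity
  rw [hq, Real.sin_add_int_mul_two_pi] at h2
  rw [add_mul, hq, one_mul, add_right_comm, Real.sin_add_int_mul_two_pi] at h1
  have hi' : i + 1 ≤ 2 * m := Finset.mem_range.1 hi
  have hpm : 0 < π / m := by positivity
  have hmi : m + 1 ≤ i := by
    by_contra! hlt
    refine h2.not_ge (Real.sin_nonneg_of_nonneg_of_le_pi (by positivity) ?_)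
    calc (i : ℝ) * (π / m) ≤ m * (π / m) := by gcongr; omega
      _ = π := by field_simp
  have hle : (i : ℝ) * (π / m) + π / m ≤ 2 * π := by
    calc (i : ℝ) * (π / m) + π / m = ((i + 1 : ℕ) : ℝ) * (π / m) := by push_cast; ring
      _ ≤ ((2 * m : ℕ) : ℝ) * (π / m) := by gcongr
      _ = 2 * π := by push_cast; field_simp
  have hge : π ≤ (i : ℝ) * (π / m) := by
    calc π = m * (π / m) := by field_simp
      _ ≤ i * (π / m) := by gcongr; omega
  refine h1.not_ge ?_
  rw [← Real.sin_sub_two_pi]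
  exact Real.sin_nonpos_of_nonpos_of_neg_pi_le (by linarith) (by linarith)

/-- The polygon circumscribed about `E` with outer normals at the angles `t + j π / m`. -/
def circumscribedPolygon (E : Set Plane) (m : ℕ) (t : ℝ) : Set Plane :=
  {x | ∀ j : ℤ, inner ℝ x (unitVec (t + j * (π / m))) ≤ supportAngle E (t + j * (π / m))}

/-- The left end of the edge with normal angle `θ` between tangents at `θ ± δ`. -/
noncomputable def edgeLower (E : Set Plane) (δ θ : ℝ) : ℝ :=
  (supportAngle E θ * Real.cos δ - supportAngle E (θ - δ)) / Real.sin δ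

/-- The right end of the edge with normal angle `θ` between tangents at `θ ± δ`. -/
noncomputable def edgeUpper (E : Set Plane) (δ θ : ℝ) : ℝ :=
  (supportAngle E (θ + δ) - supportAngle E θ * Real.cos δ) / Real.sin δ

/-- The length of the edge with normal angle `θ` between tangents at `θ ± δ`. -/
noncomputable def edgeLength (E : Set Plane) (δ θ : ℝ) : ℝ :=
  (supportAngle E (θ + δ) + supportAngle E (θ - δ) - 2 * Real.cos δ * supportAngle E θ) /
    Real.sin δ

/-- The edge with normal angle `θ` between tangents at `θ ± δ`. -/
def polygonEdge (E : Set Plane) (δ θ : ℝ) : Set Plane :=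
  (fun y : ℝ => supportAngle E θ • unitVec θ + y • unitVec (θ + π / 2)) ''
    Icc (edgeLower E δ θ) (edgeUpper E δ θ)

theorem edgeUpper_sub_edgeLower (E : Set Plane) (δ θ : ℝ) :
    edgeUpper E δ θ - edgeLower E δ θ = edgeLength E δ θ := by
  unfold edgeUpper edgeLower edgeLength
  ring

theorem subset_circumscribedPolygon {E : Set Plane} (hE : Bornology.IsBounded E) (m : ℕ) (t : ℝ) :
    E ⊆ circumscribedPolygon E m t :=
  fun _ hx _ => inner_le_supportAngle hE (subset_closure hx) _

theorem isClosed_circumscribedPolygon (E : Set Plane) (m : ℕ) (t : ℝ) :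
    IsClosed (circumscribedPolygon E m t) := by
  simp only [circumscribedPolygon, Set.ofPred_forall]
  exact isClosed_iInter fun j => isClosed_le (by fun_prop) continuous_const

theorem convex_halfspace_unitVec (θ c : ℝ) :
    Convex ℝ {x : Plane | inner ℝ x (unitVec θ) ≤ c} := by
  refine convex_halfSpace_le ⟨fun x y => inner_add_left _ _ _, fun a x => ?_⟩ c
  rw [real_inner_smul_left, smul_eq_mul]

theorem convex_circumscribedPolygon (E : Set Plane) (m : ℕ) (t : ℝ) :
    Convex ℝ (circumscribedPolygon E m t) := by
  simp only [circumscribedPolygon, Set.ofPred_forall]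
  exact convex_iInter fun j => convex_halfspace_unitVec _ _

theorem exists_range_of_int_index {m : ℕ} (hm : 0 < m) (E : Set Plane) (t : ℝ) (j : ℤ) :
    ∃ i ∈ Finset.range (2 * m),
      unitVec (t + j * (π / m)) = unitVec (t + (i : ℕ) * (π / m)) ∧
      supportAngle E (t + j * (π / m)) = supportAngle E (t + (i : ℕ) * (π / m)) := by
  obtain ⟨i, hi, q, hq⟩ := exists_lt_two_mul_angle_eq hm t j
  refine ⟨i, hi, ?_, ?_⟩
  · rw [hq]
    exact unitVec_periodic.int_mul q _
  · rw [hq]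
    exact (supportAngle_periodic E).int_mul q _

section

variable {E : Set Plane} {m : ℕ}

theorem sin_pi_div_pos (hm : 2 ≤ m) : 0 < Real.sin (π / m) := by
  have h2 : (2 : ℝ) ≤ m := by exact_mod_cast hm
  refine Real.sin_pos_of_pos_of_lt_pi (by positivity) ?_
  rw [div_lt_iff₀ (by linarith)]
  nlinarith [Real.pi_pos]

theorem inner_le_edge_iff {δ θ y : ℝ} (hδ : 0 < Real.sin δ) :
    (y ≤ edgeUpper E δ θ ↔
      supportAngle E θ * Real.cos δ + y * Real.sin δ ≤ supportAngle E (θ + δ)) ∧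
    (edgeLower E δ θ ≤ y ↔
      supportAngle E θ * Real.cos δ - y * Real.sin δ ≤ supportAngle E (θ - δ)) := by
  unfold edgeUpper edgeLower
  rw [le_div_iff₀ hδ, div_le_iff₀ hδ]
  constructor <;> constructor <;> intro h <;> linarith

theorem inner_add_angle (x : Plane) (θ δ : ℝ) :
    inner ℝ x (unitVec (θ + δ)) = inner ℝ x (unitVec θ) * Real.cos δ +
      inner ℝ x (unitVec (θ + π / 2)) * Real.sin δ := by
  rw [inner_unitVec_eq x θ, add_sub_cancel_left]

theorem inner_sub_angle (x : Plane) (θ δ : ℝ) :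
    inner ℝ x (unitVec (θ - δ)) = inner ℝ x (unitVec θ) * Real.cos δ -
      inner ℝ x (unitVec (θ + π / 2)) * Real.sin δ := by
  rw [sub_eq_add_neg, inner_add_angle, Real.cos_neg, Real.sin_neg]
  ring

theorem inner_le_of_mem_circumscribedPolygon {t : ℝ} {x : Plane}
    (hx : x ∈ circumscribedPolygon E m t) (j : ℤ) :
    inner ℝ x (unitVec (t + j * (π / m) + π / m)) ≤
      supportAngle E (t + j * (π / m) + π / m) ∧
    inner ℝ x (unitVec (t + j * (π / m) - π / m)) ≤
      supportAngle E (t + j * (π / m) - π / m) := by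
  have h1 := hx (j + 1)
  have h2 := hx (j - 1)
  have e1 : t + ((j + 1 : ℤ) : ℝ) * (π / m) = t + j * (π / m) + π / m := by push_cast; ring
  have e2 : t + ((j - 1 : ℤ) : ℝ) * (π / m) = t + j * (π / m) - π / m := by push_cast; ring
  rw [e1] at h1
  rw [e2] at h2
  exact ⟨h1, h2⟩

theorem mem_polygonEdge_of_inner_eq (hm : 2 ≤ m) {t : ℝ} {j : ℤ} {x : Plane}
    (hx : x ∈ circumscribedPolygon E m t)
    (hxj : inner ℝ x (unitVec (t + j * (π / m))) = supportAngle E (t + j * (π / m))) :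
    x ∈ polygonEdge E (π / m) (t + j * (π / m)) := by
  obtain ⟨h1, h2⟩ := inner_le_of_mem_circumscribedPolygon hx j
  rw [inner_add_angle, hxj] at h1
  rw [inner_sub_angle, hxj] at h2
  refine ⟨inner ℝ x (unitVec (t + j * (π / m) + π / 2)),
    ⟨(inner_le_edge_iff (sin_pi_div_pos hm)).2.2 h2,
      (inner_le_edge_iff (sin_pi_div_pos hm)).1.2 h1⟩, ?_⟩
  have := frame_repr x (t + j * (π / m))
  rw [hxj] at this
  exact this.symm

theorem inner_of_mem_polygonEdge {δ θ : ℝ} {x : Plane} (hx : x ∈ polygonEdge E δ θ) :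
    inner ℝ x (unitVec θ) = supportAngle E θ := by
  obtain ⟨y, -, rfl⟩ := hx
  simp only [inner_frame]
  simp

/-- Along the edge, the constraint with normal φ is affine in the position y with slope sin(φ-θ), so
only the end in the direction of that sign matters. There it is the three-term inequality for the
pair θ, θ+δ or for the pair θ-δ, θ. -/
theorem polygonEdge_subset (hE : Bornology.IsBounded E) (hne : E.Nonempty) (hm : 2 ≤ m) (t : ℝ)
    (j : ℤ) : polygonEdge E (π / m) (t + j * (π / m)) ⊆ circumscribedPolygon E m t := by
  rintro _ ⟨y, ⟨hy1, hy2⟩, rfl⟩ i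
  have hs := sin_pi_div_pos hm
  have hm0 : 0 < m := by omega
  simp only [inner_frame]
  set θ := t + j * (π / m) with hθ
  set φ := t + i * (π / m) with hφ
  set δ := π / m with hδ
  have hα : φ - θ = ((i - j : ℤ) : ℝ) * δ := by
    rw [hφ, hθ]; push_cast; ring
  refine le_of_mul_le_mul_left ?_ hs
  rcases le_total 0 (Real.sin (φ - θ)) with h | h
  · have h1 := supportAngle_three_term hE hne hs.le (θ := θ) (φ := φ) (by
      have := not_sin_pos_and_sin_neg hm0 (i - j - 1)
      rw [hα]
      convert this using 4
      · push_cast; ring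
      · push_cast; ring)
    have h2 := mul_le_mul_of_nonneg_left hy2 h
    have h3 : Real.sin δ * edgeUpper E δ θ = supportAngle E (θ + δ) - supportAngle E θ * Real.cos δ := by
      unfold edgeUpper
      field_simp
    rw [Real.sin_sub (φ - θ) δ] at h1
    have h4 := mul_le_mul_of_nonneg_left h2 hs.le
    have h5 : Real.sin δ * (Real.sin (φ - θ) * edgeUpper E δ θ) =
      Real.sin (φ - θ) * (supportAngle E (θ + δ) - supportAngle E θ * Real.cos δ) := by
      rw [← h3]; ring
    linarith
  · have h1 := supportAngle_three_term hE hne hs.le (θ := θ - δ) (φ := φ) (by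
      have := not_sin_pos_and_sin_neg hm0 (i - j)
      convert this using 4
      · rw [add_mul, one_mul, ← hδ, ← hα]; ring
      · rw [← hα]; ring)
    have h2 := mul_le_mul_of_nonpos_left hy1 h
    have h3 : Real.sin δ * edgeLower E δ θ = supportAngle E θ * Real.cos δ - supportAngle E (θ - δ) := by
      unfold edgeLower
      field_simp
    have e1 : φ - (θ - δ) = (φ - θ) + δ := by ring
    rw [e1, add_sub_cancel_right, sub_add_cancel, Real.sin_add (φ - θ) δ] at h1
    have h4 := mul_le_mul_of_nonneg_left h2 hs.le
    have h5 : Real.sin δ * (Real.sin (φ - θ) * edgeLower E δ θ) =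
      Real.sin (φ - θ) * (supportAngle E θ * Real.cos δ - supportAngle E (θ - δ)) := by
      rw [← h3]; ring
    linarith

/-- This is the three-term inequality at φ = θ - δ, divided by sin δ. -/
theorem edgeLength_nonneg (hE : Bornology.IsBounded E) (hne : E.Nonempty) (hm : 2 ≤ m) (θ : ℝ) :
    0 ≤ edgeLength E (π / m) θ := by
  have hs := sin_pi_div_pos hm
  refine div_nonneg ?_ hs.le
  have h := supportAngle_three_term hE hne hs.le (θ := θ) (φ := θ - π / m) (by
    rintro ⟨h, -⟩
    rw [sub_sub_cancel_left, Real.sin_neg] at h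
    linarith)
  rw [sub_sub_cancel_left, ← neg_add', ← two_mul, Real.sin_neg, Real.sin_neg, Real.sin_two_mul] at h
  refine le_of_mul_le_mul_left ?_ hs
  linarith

/-- Only 2m of the constraints are distinct. A point of the polygon on no edge satisfies them all
strictly, hence is interior. -/
theorem frontier_circumscribedPolygon_subset (hm : 2 ≤ m) (t : ℝ) :
    frontier (circumscribedPolygon E m t) ⊆
      ⋃ i ∈ Finset.range (2 * m), polygonEdge E (π / m) (t + (i : ℕ) * (π / m)) := by
  intro x hx
  have hxQ := (isClosed_circumscribedPolygon E m t).frontier_subset hx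
  by_contra hno
  refine hx.2 ?_
  have hopen : IsOpen (⋂ i ∈ Finset.range (2 * m), {z : Plane |
      inner ℝ z (unitVec (t + (i : ℕ) * (π / m))) < supportAngle E (t + (i : ℕ) * (π / m))}) :=
    isOpen_biInter_finset fun i _ => isOpen_lt (by fun_prop) continuous_const
  refine mem_interior.2 ⟨_, fun z hz j => ?_, hopen, ?_⟩
  · obtain ⟨i, hi, h1, h2⟩ := exists_range_of_int_index (by omega : 0 < m) E t j
    rw [h1, h2]
    exact (mem_iInter₂.1 hz i hi).le
  · refine mem_iInter₂.2 fun i hi => lt_of_le_of_ne (by simpa using hxQ i) fun heq => hno ?_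
    refine mem_iUnion₂.2 ⟨i, hi, ?_⟩
    simpa using mem_polygonEdge_of_inner_eq hm hxQ (j := i) (by simpa using heq)

theorem polygonEdge_subset_frontier (hE : Bornology.IsBounded E) (hne : E.Nonempty) (hm : 2 ≤ m)
    (t : ℝ) (j : ℤ) : polygonEdge E (π / m) (t + j * (π / m)) ⊆
      frontier (circumscribedPolygon E m t) := fun _ hx =>
  ⟨subset_closure (polygonEdge_subset hE hne hm t j hx), fun hi =>
    (inner_lt_of_mem_interior
      (E := circumscribedPolygon E m t) (fun _ hz => hz j) hi).ne (inner_of_mem_polygonEdge hx)⟩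

theorem isometry_frame (s θ : ℝ) :
    Isometry fun y : ℝ => s • unitVec θ + y • unitVec (θ + π / 2) := by
  refine Isometry.of_dist_eq fun a b => ?_
  rw [dist_eq_norm, dist_eq_norm, add_sub_add_left_eq_sub, ← sub_smul, norm_smul, norm_unitVec,
    mul_one]

theorem hausdorffMeasure_polygonEdge (E : Set Plane) (δ θ : ℝ) :
    Measure.hausdorffMeasure 1 (polygonEdge E δ θ) = ENNReal.ofReal (edgeLength E δ θ) := by
  rw [polygonEdge, (isometry_frame _ _).hausdorffMeasure_image (Or.inl zero_le_one),
    hausdorffMeasure_real, Real.volume_Icc, edgeUpper_sub_edgeLower]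

theorem isClosed_polygonEdge (E : Set Plane) (δ θ : ℝ) : IsClosed (polygonEdge E δ θ) :=
  (isCompact_Icc.image (isometry_frame _ _).continuous).isClosed

theorem sin_sub_ne_zero_or_cos_eq_neg_one (hm : 0 < m) (t : ℝ) {i j : ℕ} (hi : i < 2 * m)
    (hj : j < 2 * m) (hij : i ≠ j) :
    Real.sin (t + j * (π / m) - (t + i * (π / m))) ≠ 0 ∨
      Real.cos (t + j * (π / m) - (t + i * (π / m))) = -1 := by
  by_contra! h
  obtain ⟨h1, h2⟩ := h
  obtain ⟨n, hn⟩ := (Real.cos_eq_one_iff _).1 (((Real.sin_eq_zero_iff_cos_eq).1 h1).resolve_right h2)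
  have hm0 : (m : ℝ) ≠ 0 := by positivity
  have h3 : (2 * m * n : ℝ) = j - i := by
    field_simp at hn
    have hpi := Real.pi_ne_zero
    apply mul_right_cancel₀ hpi
    linarith
  have h4 : 2 * (m : ℤ) * n = j - i := by exact_mod_cast h3
  rcases lt_trichotomy n 0 with hn0 | hn0 | hn0
  · nlinarith
  · subst hn0; omega
  · nlinarith

/-- Two edges lie on two tangent lines. Opposite normals would force two support values to add up to
zero, against positivity; otherwise the lines are not parallel and share at most one point. -/
theorem hausdorffMeasure_polygonEdge_inter (hpos : ∀ θ, 0 < supportAngle E θ) (hm : 2 ≤ m) (t : ℝ)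
    {i j : ℕ} (hi : i < 2 * m) (hj : j < 2 * m) (hij : i ≠ j) :
    Measure.hausdorffMeasure 1 (polygonEdge E (π / m) (t + i * (π / m)) ∩
      polygonEdge E (π / m) (t + j * (π / m))) = 0 := by
  have : NullSingletonClass (Measure.hausdorffMeasure 1 : Measure Plane) :=
    Measure.nullSingletonClass_hausdorff Plane one_pos
  refine Set.Subsingleton.measure_zero (fun x hx x' hx' => ?_) _
  have hxi := inner_of_mem_polygonEdge hx.1
  have hxj := inner_of_mem_polygonEdge hx.2
  have hxi' := inner_of_mem_polygonEdge hx'.1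
  have hxj' := inner_of_mem_polygonEdge hx'.2
  rw [inner_unitVec_eq _ (t + i * (π / m)), hxi] at hxj
  rw [inner_unitVec_eq _ (t + i * (π / m)), hxi'] at hxj'
  have hsin : Real.sin (t + j * (π / m) - (t + i * (π / m))) ≠ 0 := by
    rcases sin_sub_ne_zero_or_cos_eq_neg_one (by omega) t hi hj hij with h | h
    · exact h
    · intro h0
      rw [h, h0] at hxj
      linarith [hpos (t + i * (π / m)), hpos (t + j * (π / m))]
  have := mul_right_cancel₀ hsin (add_left_cancel (hxj.trans hxj'.symm))
  rw [frame_repr x (t + i * (π / m)), frame_repr x' (t + i * (π / m)), hxi, hxi', this]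

theorem hausdorffMeasure_frontier_circumscribedPolygon (hE : Bornology.IsBounded E)
    (hne : E.Nonempty) (hpos : ∀ θ, 0 < supportAngle E θ) (hm : 2 ≤ m) (t : ℝ) :
    Measure.hausdorffMeasure 1 (frontier (circumscribedPolygon E m t)) =
      ENNReal.ofReal (∑ i ∈ Finset.range (2 * m), edgeLength E (π / m) (t + i * (π / m))) := by
  have h : frontier (circumscribedPolygon E m t) =
      ⋃ i ∈ Finset.range (2 * m), polygonEdge E (π / m) (t + (i : ℕ) * (π / m)) :=
    (frontier_circumscribedPolygon_subset hm t).antisymm (iUnion₂_subset fun i _ => by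
      simpa using polygonEdge_subset_frontier hE hne hm t i)
  rw [h, measure_biUnion_finset₀, ENNReal.ofReal_sum_of_nonneg]
  · exact Finset.sum_congr rfl fun i _ => hausdorffMeasure_polygonEdge _ _ _
  · exact fun i _ => edgeLength_nonneg hE hne hm _
  · intro i hi j hj hij
    exact hausdorffMeasure_polygonEdge_inter hpos hm t (by simpa using hi) (by simpa using hj) hij
  · exact fun i _ => (isClosed_polygonEdge _ _ _).measurableSet.nullMeasurableSet

end

/-! ### Circumscribed polygons inside dilates of the convex set -/

section

open scoped Pointwise

variable {E : Set Plane}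

theorem abs_supportAngle_le (hne : E.Nonempty) {R : ℝ} (hR : ∀ x ∈ E, ‖x‖ ≤ R) (θ : ℝ) :
    |supportAngle E θ| ≤ R := by
  have hb : ∀ y ∈ E, |inner ℝ y (unitVec θ)| ≤ R := fun y hy => by
    have := abs_real_inner_le_norm y (unitVec θ)
    rw [norm_unitVec, mul_one] at this
    exact this.trans (hR y hy)
  refine abs_le.2 ⟨?_, supportAngle_le hne fun y hy => (abs_le.1 (hb y hy)).2⟩
  obtain ⟨y, hy⟩ := hne
  exact (abs_le.1 (hb y hy)).1.trans (inner_le_supportAngle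
    (isBounded_iff_forall_norm_le.2 ⟨R, hR⟩) (subset_closure hy) θ)

theorem exists_int_abs_sub_le {δ : ℝ} (hδ : 0 < δ) (t φ : ℝ) : ∃ j : ℤ, |φ - (t + j * δ)| ≤ δ := by
  refine ⟨⌊(φ - t) / δ⌋, ?_⟩
  have h1 := Int.floor_le ((φ - t) / δ)
  have h2 := Int.lt_floor_add_one ((φ - t) / δ)
  rw [le_div_iff₀ hδ] at h1
  rw [div_lt_iff₀ hδ] at h2
  rw [abs_le]
  constructor <;> linarith

/-- For m ≥ 3 some normal is within π/3 of the direction of x, and cos(π/3) = 1/2 gives the factor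
2. -/
theorem norm_le_of_mem_circumscribedPolygon {m : ℕ} (hm : 3 ≤ m) {R : ℝ}
    (hR : ∀ θ, supportAngle E θ ≤ R) {t : ℝ} {x : Plane} (hx : x ∈ circumscribedPolygon E m t) :
    ‖x‖ ≤ 2 * R := by
  obtain ⟨φ, hφ⟩ := exists_eq_norm_smul_unitVec x
  have hm3 : (3 : ℝ) ≤ m := by exact_mod_cast hm
  obtain ⟨j, hj⟩ := exists_int_abs_sub_le (δ := π / m) (by positivity) t φ
  have h1 := (hx j).trans (hR _)
  have h2 : inner ℝ x (unitVec (t + j * (π / m))) = ‖x‖ * Real.cos (φ - (t + j * (π / m))) := by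
    conv_lhs => rw [hφ, real_inner_smul_left, inner_unitVec]
    rw [Real.cos_sub]
    simp [unitVec]
  have h3 : 1 / 2 ≤ Real.cos (φ - (t + j * (π / m))) := by
    rw [← Real.cos_pi_div_three, ← Real.cos_abs (φ - _)]
    refine Real.cos_le_cos_of_nonneg_of_le_pi (abs_nonneg _) (by linarith [Real.pi_pos])
      (hj.trans ?_)
    gcongr
  rw [h2] at h1
  have := mul_le_mul_of_nonneg_left h3 (norm_nonneg x)
  linarith

theorem inner_unitVec_sub_le (x : Plane) (φ ψ : ℝ) :
    inner ℝ x (unitVec φ) ≤ inner ℝ x (unitVec ψ) + 2 * ‖x‖ * |φ - ψ| := by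
  have h2 : |Real.cos φ - Real.cos ψ| ≤ |φ - ψ| := by
    simpa [Real.dist_eq] using Real.lipschitzWith_cos.dist_le_mul φ ψ
  have h3 : |Real.sin φ - Real.sin ψ| ≤ |φ - ψ| := by
    simpa [Real.dist_eq] using Real.lipschitzWith_sin.dist_le_mul φ ψ
  have h4 : ∀ i, |x i| ≤ ‖x‖ := fun i => PiLp.norm_apply_le x i
  have h5 : x 0 * (Real.cos φ - Real.cos ψ) ≤ ‖x‖ * |φ - ψ| :=
    (le_abs_self _).trans (by rw [abs_mul]; gcongr; exact h4 0)
  have h6 : x 1 * (Real.sin φ - Real.sin ψ) ≤ ‖x‖ * |φ - ψ| :=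
    (le_abs_self _).trans (by rw [abs_mul]; gcongr; exact h4 1)
  rw [inner_unitVec, inner_unitVec]
  linarith

/-- Circumscribed equiangular polygons are close to the convex set, up to dilation. -/
theorem exists_circumscribedPolygon_subset_smul (hE : Bornology.IsBounded E) (hc : Convex ℝ E)
    (hne : E.Nonempty) {r : ℝ} (hr : 0 < r) (hpos : ∀ θ, r ≤ supportAngle E θ) :
    ∃ C, 0 ≤ C ∧ ∀ m : ℕ, 3 ≤ m → ∀ t,
      circumscribedPolygon E m t ⊆ (1 + C * (π / m)) • closure E := by
  obtain ⟨K, hK⟩ := supportAngle_lipschitz hE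
  obtain ⟨R, hR0, hR⟩ := hE.exists_pos_norm_le
  have hpR : ∀ θ, supportAngle E θ ≤ R := fun θ =>
    (le_abs_self _).trans (abs_supportAngle_le hne hR θ)
  -- Moving from φ to the nearest normal costs at most Kδ in the support function and 2‖x‖δ ≤ 4Rδ in
  -- the inner product. Since the support function is at least r, a dilation absorbs this additive
  -- error once it is divided by r.
  refine ⟨(K + 4 * R) / r, by positivity, fun m hm t x hx => ?_⟩
  have hm0 : (0 : ℝ) < m := by positivity
  set δ := π / m with hδ
  have hδ0 : 0 < δ := by positivity
  have hη : 0 < 1 + (K + 4 * R) / r * δ := by positivity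
  rw [mem_smul_set_iff_inv_smul_mem₀ hη.ne', mem_closure_iff_inner_le_supportAngle hE hc hne]
  intro φ
  rw [real_inner_smul_left, inv_mul_le_iff₀ hη]
  obtain ⟨j, hj⟩ := exists_int_abs_sub_le hδ0 t φ
  have h1 := inner_unitVec_sub_le x φ (t + j * δ)
  have h2 := hx j
  have h3 := norm_le_of_mem_circumscribedPolygon hm hpR hx
  have h4 : supportAngle E (t + j * δ) ≤ supportAngle E φ + K * |φ - (t + j * δ)| := by
    have := hK.dist_le_mul (t + j * δ) φ
    rw [Real.dist_eq, Real.dist_eq, abs_sub_comm _ φ] at this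
    linarith [le_abs_self (supportAngle E (t + j * δ) - supportAngle E φ)]
  have h5 : (K : ℝ) * |φ - (t + j * δ)| ≤ K * δ := by gcongr
  have h6 : 2 * ‖x‖ * |φ - (t + j * δ)| ≤ 2 * (2 * R) * δ := by gcongr
  have h7 : (K + 4 * R) * δ ≤ (K + 4 * R) / r * δ * supportAngle E φ := by
    have : (K + 4 * R) * δ = (K + 4 * R) / r * δ * r := by field_simp
    rw [this]
    exact mul_le_mul_of_nonneg_left (hpos φ) (by positivity)
  linarith

theorem hausdorffMeasure_frontier_smul {c : ℝ} (hc : 0 < c) (s : Set Plane) :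
    Measure.hausdorffMeasure 1 (frontier (c • s)) =
      ENNReal.ofReal c * Measure.hausdorffMeasure 1 (frontier s) := by
  have h : frontier (c • s) = c • frontier s := by
    simp only [frontier]
    rw [closure_smul₀' hc.ne', interior_smul₀ hc.ne', smul_set_sdiff₀ hc.ne']
  rw [h, Measure.hausdorffMeasure_smul₀ zero_le_one hc.ne', NNReal.rpow_one, ENNReal.smul_def,
    smul_eq_mul]
  congr 1
  rw [← enorm_eq_nnnorm, ← ofReal_norm, Real.norm_of_nonneg hc.le]

end

/-! ### Averaging over rotations of the partition -/

/-- The 2m shifts of [0, π/m] tile a period. Averaging over t thus makes the polygon sums exact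
integrals, with no Riemann-sum limit. -/
theorem integral_sum_shift {m : ℕ} (hm : 0 < m) {g : ℝ → ℝ} (hg : Continuous g) :
    ∫ t in 0..π / m, ∑ i ∈ Finset.range (2 * m), g (t + i * (π / m)) = ∫ t in 0..2 * π, g t := by
  rw [intervalIntegral.integral_finsetSum fun i _ =>
    Continuous.intervalIntegrable (by fun_prop) _ _]
  have h := intervalIntegral.sum_integral_adjacent_intervals (f := g) (μ := volume)
    (a := fun i : ℕ => (i : ℝ) * (π / m)) (n := 2 * m) fun k _ => hg.intervalIntegrable _ _
  have e : ((2 * m : ℕ) : ℝ) * (π / m) = 2 * π := by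
    have : (m : ℝ) ≠ 0 := by positivity
    push_cast
    field_simp
  simp only [Nat.cast_zero, zero_mul, e] at h
  rw [← h]
  refine Finset.sum_congr rfl fun i _ => ?_
  rw [intervalIntegral.integral_comp_add_right]
  push_cast
  ring_nf

theorem mul_le_integral_of_le_sum_shift {m : ℕ} (hm : 0 < m) {g : ℝ → ℝ} (hg : Continuous g)
    {c : ℝ} (h : ∀ t, c ≤ ∑ i ∈ Finset.range (2 * m), g (t + i * (π / m))) :
    π / m * c ≤ ∫ t in 0..2 * π, g t := by
  rw [← integral_sum_shift hm hg]
  have := intervalIntegral.integral_mono_on (a := 0) (b := π / m) (μ := volume) (by positivity)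
    (intervalIntegrable_const (c := c))
    (Continuous.intervalIntegrable (u := fun t => ∑ i ∈ Finset.range (2 * m), g (t + i * (π / m)))
      (by fun_prop) _ _) fun t _ => h t
  simpa using this

theorem integral_le_mul_of_sum_shift_le {m : ℕ} (hm : 0 < m) {g : ℝ → ℝ} (hg : Continuous g)
    {c : ℝ} (h : ∀ t, ∑ i ∈ Finset.range (2 * m), g (t + i * (π / m)) ≤ c) :
    ∫ t in 0..2 * π, g t ≤ π / m * c := by
  have := mul_le_integral_of_le_sum_shift hm hg.neg (c := -c) fun t => by
    simpa using h t
  simp only [Pi.neg_apply, intervalIntegral.integral_neg] at this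
  linarith

theorem integral_period_comp_add {g : ℝ → ℝ} (hg : Function.Periodic g (2 * π)) (δ : ℝ) :
    ∫ θ in 0..2 * π, g (θ + δ) = ∫ θ in 0..2 * π, g θ := by
  rw [intervalIntegral.integral_comp_add_right, zero_add, add_comm]
  simpa using hg.intervalIntegral_add_eq δ 0

theorem integral_period_comp_sub {g : ℝ → ℝ} (hg : Function.Periodic g (2 * π)) (δ : ℝ) :
    ∫ θ in 0..2 * π, g (θ - δ) = ∫ θ in 0..2 * π, g θ :=
  integral_period_comp_add hg (-δ)

theorem tendsto_pi_div_atTop : Filter.Tendsto (fun m : ℕ => π / m) Filter.atTop (nhds 0) :=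
  tendsto_const_div_atTop_nhds_zero_nat π

/-- By half angles the quotient is tan(δ/2)/(δ/2) with δ = π/m; `Real.sinc` makes it continuous at
0. -/
theorem tendsto_cos_div_sin :
    Filter.Tendsto (fun m : ℕ => (2 - 2 * Real.cos (π / m)) / (π / m * Real.sin (π / m)))
      Filter.atTop (nhds 1) := by
  have hc : Filter.Tendsto (fun δ : ℝ => Real.sinc (δ / 2) / Real.cos (δ / 2)) (nhds 0)
      (nhds 1) := by
    have : ContinuousAt (fun δ : ℝ => Real.sinc (δ / 2) / Real.cos (δ / 2)) 0 :=
      ContinuousAt.div (by fun_prop) (by fun_prop) (by simp)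
    simpa [ContinuousAt] using this
  refine (hc.comp tendsto_pi_div_atTop).congr' ?_
  filter_upwards [Filter.eventually_ge_atTop 2] with m hm
  have hs := sin_pi_div_pos hm
  have hm0 : (m : ℝ) ≠ 0 := by positivity
  simp only [Function.comp_apply]
  set δ := π / m with hδ
  have hδ0 : δ ≠ 0 := by positivity
  have e1 : Real.sin δ = 2 * Real.sin (δ / 2) * Real.cos (δ / 2) := by
    rw [← Real.sin_two_mul]; ring_nf
  have e2 : Real.cos δ = 1 - 2 * Real.sin (δ / 2) ^ 2 := by
    have h := Real.cos_two_mul' (δ / 2)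
    rw [mul_div_cancel₀ δ (two_ne_zero' ℝ)] at h
    linarith [Real.cos_sq_add_sin_sq (δ / 2)]
  have hne : Real.sin (δ / 2) ≠ 0 ∧ Real.cos (δ / 2) ≠ 0 := by
    constructor <;> · intro h; rw [h] at e1; simp at e1; exact hs.ne' e1
  rw [Real.sinc_of_ne_zero (by positivity), e1, e2]
  have := hne.1
  have := hne.2
  field_simp
  ring

/-! ### Cauchy's formula for the perimeter -/

section

open scoped Pointwise

variable {E : Set Plane}

theorem continuous_edgeLength (hE : Bornology.IsBounded E) (δ : ℝ) :
    Continuous (edgeLength E δ) := by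
  obtain ⟨K, hK⟩ := supportAngle_lipschitz hE
  have := hK.continuous
  unfold edgeLength
  fun_prop

theorem integral_edgeLength (hE : Bornology.IsBounded E) (δ : ℝ) :
    ∫ θ in 0..2 * π, edgeLength E δ θ =
      (2 - 2 * Real.cos δ) / Real.sin δ * ∫ θ in 0..2 * π, supportAngle E θ := by
  obtain ⟨K, hK⟩ := supportAngle_lipschitz hE
  have hc := hK.continuous
  have hT : ∀ {g : ℝ → ℝ}, Continuous g → IntervalIntegrable g volume 0 (2 * π) :=
    fun hg => hg.intervalIntegrable _ _
  unfold edgeLength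
  rw [intervalIntegral.integral_div, intervalIntegral.integral_sub (hT (by fun_prop))
    (hT (by fun_prop)), intervalIntegral.integral_add (hT (by fun_prop)) (hT (by fun_prop)),
    integral_period_comp_add (supportAngle_periodic E),
    integral_period_comp_sub (supportAngle_periodic E), intervalIntegral.integral_const_mul]
  ring

/-- Cauchy's formula for compact convex sets with the origin in the interior. -/
theorem perimeter_eq_integral_of_pos (hE : Bornology.IsBounded E) (hc : Convex ℝ E)
    (hcl : IsClosed E) (hi : (interior E).Nonempty) {r : ℝ} (hr : 0 < r)
    (hpos : ∀ θ, r ≤ supportAngle E θ) :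
    perimeter E = ∫ θ in 0..2 * π, supportAngle E θ := by
  have hne := hi.mono interior_subset
  have hpos' : ∀ θ, 0 < supportAngle E θ := fun θ => hr.trans_le (hpos θ)
  obtain ⟨C, hC0, hC⟩ := exists_circumscribedPolygon_subset_smul hE hc hne hr hpos
  rw [hcl.closure_eq] at hC
  have hQb : ∀ m : ℕ, 3 ≤ m → ∀ t, Bornology.IsBounded (circumscribedPolygon E m t) :=
    fun m hm t => (hE.smul₀ _).subset (hC m hm t)
  have hup : ∀ m : ℕ, 3 ≤ m → ∀ t, Measure.hausdorffMeasure 1 (frontier E) ≤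
      ENNReal.ofReal (∑ i ∈ Finset.range (2 * m), edgeLength E (π / m) (t + i * (π / m))) :=
    fun m hm t => by
      rw [← hausdorffMeasure_frontier_circumscribedPolygon hE hne hpos' (by omega) t]
      exact hausdorffMeasure_frontier_mono hc hcl hi (hQb m hm t)
        (subset_circumscribedPolygon hE m t)
  have hfin : Measure.hausdorffMeasure 1 (frontier E) ≠ ⊤ :=
    ((hup 3 le_rfl 0).trans_lt ENNReal.ofReal_lt_top).ne
  have hsum0 : ∀ m : ℕ, 3 ≤ m → ∀ t,
      0 ≤ ∑ i ∈ Finset.range (2 * m), edgeLength E (π / m) (t + i * (π / m)) :=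
    fun m hm t => Finset.sum_nonneg fun i _ => edgeLength_nonneg hE hne (by omega) _
  have hup' : ∀ m : ℕ, 3 ≤ m → ∀ t, perimeter E ≤
      ∑ i ∈ Finset.range (2 * m), edgeLength E (π / m) (t + i * (π / m)) := fun m hm t =>
    ENNReal.toReal_le_of_le_ofReal (hsum0 m hm t) (hup m hm t)
  have hlow : ∀ m : ℕ, 3 ≤ m → ∀ t,
      ∑ i ∈ Finset.range (2 * m), edgeLength E (π / m) (t + i * (π / m)) ≤
        (1 + C * (π / m)) * perimeter E := fun m hm t => by
    have hη : 0 < 1 + C * (π / m) := by positivity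
    have h := hausdorffMeasure_frontier_mono (convex_circumscribedPolygon E m t)
      (isClosed_circumscribedPolygon E m t)
      (hi.mono (interior_mono (subset_circumscribedPolygon hE m t)))
      (hE.smul₀ _) (hC m hm t)
    rw [hausdorffMeasure_frontier_circumscribedPolygon hE hne hpos' (by omega) t,
      hausdorffMeasure_frontier_smul hη, ← ENNReal.ofReal_toReal hfin,
      ← ENNReal.ofReal_mul hη.le, ENNReal.ofReal_le_ofReal_iff (by positivity)] at h
    exact h
  -- The bounds `hup'` and `hlow` hold for every rotation t; integrating them over one step of
  -- length π/m replaces the sum of edge lengths by a multiple of ∫ p.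
  have hk : ∀ m : ℕ, 3 ≤ m → perimeter E ≤ (2 - 2 * Real.cos (π / m)) /
      (π / m * Real.sin (π / m)) * (∫ θ in 0..2 * π, supportAngle E θ) ∧
      (2 - 2 * Real.cos (π / m)) / (π / m * Real.sin (π / m)) *
        (∫ θ in 0..2 * π, supportAngle E θ) ≤ (1 + C * (π / m)) * perimeter E := fun m hm => by
    have hg := continuous_edgeLength hE (π / m)
    have h1 := mul_le_integral_of_le_sum_shift (by omega : 0 < m) hg (hup' m hm)
    have h2 := integral_le_mul_of_sum_shift_le (by omega : 0 < m) hg (hlow m hm)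
    rw [integral_edgeLength hE] at h1 h2
    have hδ : 0 < π / m := by positivity
    have e : (2 - 2 * Real.cos (π / m)) / (π / m * Real.sin (π / m)) *
        (∫ θ in 0..2 * π, supportAngle E θ) = (2 - 2 * Real.cos (π / m)) / Real.sin (π / m) *
        (∫ θ in 0..2 * π, supportAngle E θ) / (π / m) := by
      rw [mul_comm (π / m), ← div_div]
      ring
    rw [e, le_div_iff₀ hδ, div_le_iff₀ hδ]
    constructor <;> linarith
  have ht := tendsto_cos_div_sin.mul_const (∫ θ in 0..2 * π, supportAngle E θ)
  rw [one_mul] at ht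
  have ht2 : Filter.Tendsto (fun m : ℕ => (1 + C * (π / m)) * perimeter E) Filter.atTop
      (nhds (perimeter E)) := by
    simpa using ((tendsto_pi_div_atTop.const_mul C).const_add 1).mul_const (perimeter E)
  refine le_antisymm (ge_of_tendsto ht ?_) (le_of_tendsto_of_tendsto ht ht2 ?_)
  · filter_upwards [Filter.eventually_ge_atTop 3] with m hm using (hk m hm).1
  · filter_upwards [Filter.eventually_ge_atTop 3] with m hm using (hk m hm).2

end

/-! ### Area -/

theorem unitVec_add_pi (θ : ℝ) : unitVec (θ + π) = -unitVec θ := by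
  ext i
  fin_cases i <;> simp [unitVec]

theorem inner_unitVec_unitVec (θ φ : ℝ) :
    inner ℝ (unitVec θ) (unitVec φ) = Real.cos (φ - θ) := by
  rw [inner_unitVec, Real.cos_sub]
  simp [unitVec]
  ring

theorem measurePreserving_frame (θ : ℝ) :
    MeasurePreserving (fun x : Plane =>
      ((inner ℝ x (unitVec θ), inner ℝ x (unitVec (θ + π / 2))) : ℝ × ℝ)) volume volume := by
  have hon : Orthonormal ℝ ![unitVec θ, unitVec (θ + π / 2)] := by
    constructor
    · intro i
      fin_cases i <;> simp [norm_unitVec]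
    · intro i j hij
      fin_cases i <;> fin_cases j <;> simp [inner_unitVec_unitVec] at hij ⊢
  have hsp : ⊤ ≤ Submodule.span ℝ (range ![unitVec θ, unitVec (θ + π / 2)]) := fun x _ => by
    rw [frame_repr x θ]
    refine Submodule.add_mem _ (Submodule.smul_mem _ _ (Submodule.subset_span ⟨0, rfl⟩))
      (Submodule.smul_mem _ _ (Submodule.subset_span ⟨1, rfl⟩))
  let b := OrthonormalBasis.mk hon hsp
  have h := (volume_preserving_finTwoArrow ℝ).comp
    ((PiLp.volume_preserving_ofLp (Fin 2)).comp b.measurePreserving_repr)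
  convert h using 1
  funext x
  simp [b, OrthonormalBasis.repr_apply_apply, real_inner_comm, MeasurableEquiv.finTwoArrow]

/-- The set is the triangle with apex 0 over the segment {p} × [a, b]; its slice at s is that
segment shrunk by s/p. -/
theorem volume_triangle {p a b : ℝ} (hp : 0 < p) (hab : a ≤ b) :
    volume {z : ℝ × ℝ | (0 ≤ z.1 ∧ z.1 ≤ p) ∧ z.1 * a ≤ p * z.2 ∧ p * z.2 ≤ z.1 * b} =
      ENNReal.ofReal (p * (b - a) / 2) := by
  have hm : MeasurableSet
      {z : ℝ × ℝ | (0 ≤ z.1 ∧ z.1 ≤ p) ∧ z.1 * a ≤ p * z.2 ∧ p * z.2 ≤ z.1 * b} := by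
    measurability
  rw [Measure.volume_eq_prod, Measure.prod_apply hm]
  have hslice : ∀ s : ℝ, volume (Prod.mk s ⁻¹'
      {z : ℝ × ℝ | (0 ≤ z.1 ∧ z.1 ≤ p) ∧ z.1 * a ≤ p * z.2 ∧ p * z.2 ≤ z.1 * b}) =
      (Icc 0 p).indicator (fun s => ENNReal.ofReal (s * ((b - a) / p))) s := fun s => by
    by_cases hs : s ∈ Icc 0 p
    · rw [indicator_of_mem hs]
      have : Prod.mk s ⁻¹' {z : ℝ × ℝ | (0 ≤ z.1 ∧ z.1 ≤ p) ∧ z.1 * a ≤ p * z.2 ∧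
          p * z.2 ≤ z.1 * b} = Icc (s * a / p) (s * b / p) := by
        ext y
        simp only [mem_preimage, mem_ofPred_eq, mem_Icc, div_le_iff₀ hp, le_div_iff₀ hp,
          mul_comm y p]
        exact and_iff_right hs
      rw [this, Real.volume_Icc]
      congr 1
      ring
    · rw [indicator_of_notMem hs]
      refine measure_mono_null (fun y hy => hs hy.1) measure_empty
  simp_rw [hslice]
  rw [lintegral_indicator measurableSet_Icc, ← ofReal_integral_eq_lintegral_ofReal]
  · rw [integral_Icc_eq_integral_Ioc, ← intervalIntegral.integral_of_le hp.le,
      intervalIntegral.integral_mul_const, integral_id]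
    congr 1
    field_simp
    ring
  · exact (Continuous.integrableOn_Icc (by fun_prop))
  · refine (ae_restrict_iff' measurableSet_Icc).2 (Filter.Eventually.of_forall fun s hs => ?_)
    exact mul_nonneg hs.1 (div_nonneg (sub_nonneg.2 hab) hp.le)

/-- The part of the circumscribed polygon lying in the cone over one of its edges. -/
def polygonSector (E : Set Plane) (m : ℕ) (t : ℝ) (i : ℕ) : Set Plane :=
  {x | x ∈ circumscribedPolygon E m t ∧ ∀ j : ℤ,
    supportAngle E (t + i * (π / m)) * inner ℝ x (unitVec (t + j * (π / m))) ≤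
      supportAngle E (t + j * (π / m)) * inner ℝ x (unitVec (t + i * (π / m)))}

section

variable {E : Set Plane} {m : ℕ}

/-- In the frame of the i-th normal the sector is the triangle over the i-th edge. The neighbouring
normals cut out its two sides; conversely, a point of the triangle is projected from the origin onto
the edge, where `polygonEdge_subset` supplies all the constraints. -/
theorem mem_polygonSector_iff (hE : Bornology.IsBounded E) (hne : E.Nonempty)
    (hpos : ∀ θ, 0 < supportAngle E θ) (hm : 2 ≤ m) (t : ℝ) (i : ℕ) (x : Plane) :
    x ∈ polygonSector E m t i ↔
      (0 ≤ inner ℝ x (unitVec (t + i * (π / m))) ∧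
        inner ℝ x (unitVec (t + i * (π / m))) ≤ supportAngle E (t + i * (π / m))) ∧
      inner ℝ x (unitVec (t + i * (π / m))) * edgeLower E (π / m) (t + i * (π / m)) ≤
        supportAngle E (t + i * (π / m)) * inner ℝ x (unitVec (t + i * (π / m) + π / 2)) ∧
      supportAngle E (t + i * (π / m)) * inner ℝ x (unitVec (t + i * (π / m) + π / 2)) ≤
        inner ℝ x (unitVec (t + i * (π / m))) * edgeUpper E (π / m) (t + i * (π / m)) := by
  have hsin := sin_pi_div_pos hm
  have hedge := polygonEdge_subset hE hne hm t (i : ℤ)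
  rw [Int.cast_natCast] at hedge
  have hp := hpos (t + i * (π / m))
  constructor
  · rintro ⟨hQ, hx⟩
    -- Index `i + m` is the opposite normal, which forces the first coordinate to be nonnegative.
    have h0 := hx (i + m)
    have h1 := hx (i + 1)
    have h2 := hx (i - 1)
    have h3 := hQ i
    have hm0 : (m : ℝ) ≠ 0 := by positivity
    have e0 : t + ((i + m : ℤ) : ℝ) * (π / m) = t + i * (π / m) + π := by
      push_cast; field_simp; ring
    have e1 : t + ((i + 1 : ℤ) : ℝ) * (π / m) = t + i * (π / m) + π / m := by push_cast; ring
    have e2 : t + ((i - 1 : ℤ) : ℝ) * (π / m) = t + i * (π / m) - π / m := by push_cast; ring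
    rw [e0, unitVec_add_pi, inner_neg_right] at h0
    rw [e1, inner_add_angle] at h1
    rw [e2, inner_sub_angle] at h2
    rw [Int.cast_natCast] at h3
    set θ := t + i * (π / m)
    set s := inner ℝ x (unitVec θ)
    set y := inner ℝ x (unitVec (θ + π / 2))
    refine ⟨⟨?_, h3⟩, ?_, ?_⟩
    · by_contra! hneg
      nlinarith [hpos (θ + π)]
    · unfold edgeLower
      rw [mul_div_assoc', div_le_iff₀ hsin]
      linarith
    · unfold edgeUpper
      rw [mul_div_assoc', le_div_iff₀ hsin]
      linarith
  · rintro ⟨⟨hs0, hs1⟩, ha, hb⟩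
    have hkey : ∀ j : ℤ,
        supportAngle E (t + i * (π / m)) * inner ℝ x (unitVec (t + j * (π / m))) ≤
        supportAngle E (t + j * (π / m)) * inner ℝ x (unitVec (t + i * (π / m))) := by
      intro j
      rw [inner_unitVec_eq x (t + i * (π / m)) (t + j * (π / m))]
      set θ := t + i * (π / m)
      set s := inner ℝ x (unitVec θ)
      set y := inner ℝ x (unitVec (θ + π / 2))
      rcases hs0.eq_or_lt with h0 | h0
      · rw [← h0] at ha hb ⊢
        have : y = 0 := by
          have : supportAngle E θ * y = 0 := le_antisymm (by simpa using hb) (by simpa using ha)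
          exact (mul_eq_zero.1 this).resolve_left hp.ne'
        simp [this]
      -- This is x rescaled by p(θ)/s to lie on the tangent line.
      · have hmem : supportAngle E θ • unitVec θ + (supportAngle E θ * y / s) •
            unitVec (θ + π / 2) ∈ polygonEdge E (π / m) θ :=
          ⟨_, ⟨by rw [le_div_iff₀ h0]; linarith, by rw [div_le_iff₀ h0]; linarith⟩, rfl⟩
        have h := hedge hmem j
        rw [inner_frame] at h
        have h' := mul_le_mul_of_nonneg_right h h0.le
        have e : (supportAngle E θ * Real.cos (t + j * (π / m) - θ) + supportAngle E θ * y / s *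
            Real.sin (t + j * (π / m) - θ)) * s = supportAngle E θ *
            (s * Real.cos (t + j * (π / m) - θ) + y * Real.sin (t + j * (π / m) - θ)) := by
          field_simp
        rwa [e] at h'
    refine ⟨fun j => ?_, hkey⟩
    refine le_of_mul_le_mul_left ((hkey j).trans ?_) hp
    rw [mul_comm (supportAngle E (t + i * (π / m)))]
    exact mul_le_mul_of_nonneg_left hs1 (hpos _).le

theorem volume_polygonSector (hE : Bornology.IsBounded E) (hne : E.Nonempty)
    (hpos : ∀ θ, 0 < supportAngle E θ) (hm : 2 ≤ m) (t : ℝ) (i : ℕ) :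
    MeasurableSet (polygonSector E m t i) ∧ volume (polygonSector E m t i) =
      ENNReal.ofReal (supportAngle E (t + i * (π / m)) *
        edgeLength E (π / m) (t + i * (π / m)) / 2) := by
  set θ := t + i * (π / m) with hθ
  have hR : MeasurableSet {z : ℝ × ℝ | (0 ≤ z.1 ∧ z.1 ≤ supportAngle E θ) ∧
      z.1 * edgeLower E (π / m) θ ≤ supportAngle E θ * z.2 ∧
      supportAngle E θ * z.2 ≤ z.1 * edgeUpper E (π / m) θ} := by
    measurability
  have heq : polygonSector E m t i = (fun x : Plane =>
      ((inner ℝ x (unitVec θ), inner ℝ x (unitVec (θ + π / 2))) : ℝ × ℝ)) ⁻¹'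
      {z : ℝ × ℝ | (0 ≤ z.1 ∧ z.1 ≤ supportAngle E θ) ∧
      z.1 * edgeLower E (π / m) θ ≤ supportAngle E θ * z.2 ∧
      supportAngle E θ * z.2 ≤ z.1 * edgeUpper E (π / m) θ} := by
    ext x
    exact mem_polygonSector_iff hE hne hpos hm t i x
  have hmp := measurePreserving_frame θ
  rw [heq]
  refine ⟨hmp.measurable hR, ?_⟩
  rw [hmp.measure_preimage hR.nullMeasurableSet, volume_triangle (hpos θ),
    edgeUpper_sub_edgeLower]
  have := edgeLength_nonneg hE hne hm θ
  rw [← edgeUpper_sub_edgeLower] at this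
  linarith

/-- The intersection lies on the line orthogonal to w, which has measure zero once w ≠ 0. The
normals are distinct, and if they are opposite the positive support values cannot cancel. -/
theorem volume_polygonSector_inter (hpos : ∀ θ, 0 < supportAngle E θ) (hm : 2 ≤ m) (t : ℝ)
    {i j : ℕ} (hi : i < 2 * m) (hj : j < 2 * m) (hij : i ≠ j) :
    volume (polygonSector E m t i ∩ polygonSector E m t j) = 0 := by
  set θ := t + i * (π / m) with hθ
  set φ := t + j * (π / m) with hφ
  set w : Plane := supportAngle E θ • unitVec φ - supportAngle E φ • unitVec θ with hw
  have hw0 : w ≠ 0 := by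
    intro h0
    have h1 : inner ℝ w (unitVec θ) = 0 := by rw [h0, inner_zero_left]
    have h2 : inner ℝ w (unitVec (θ + π / 2)) = 0 := by rw [h0, inner_zero_left]
    simp only [hw, inner_sub_left, real_inner_smul_left, inner_unitVec_unitVec] at h1 h2
    have e1 : Real.cos (θ - φ) = Real.cos (φ - θ) := by rw [← Real.cos_neg, neg_sub]
    have e2 : Real.cos (θ + π / 2 - φ) = Real.sin (φ - θ) := by
      rw [← Real.cos_pi_div_two_sub]; ring_nf
    rw [e1] at h1
    rw [e2, add_sub_cancel_left, Real.cos_pi_div_two] at h2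
    rw [sub_self, Real.cos_zero] at h1
    have hs : Real.sin (φ - θ) = 0 :=
      (mul_eq_zero.1 (by linarith : supportAngle E θ * Real.sin (φ - θ) = 0)).resolve_left
        (hpos θ).ne'
    rcases sin_sub_ne_zero_or_cos_eq_neg_one (by omega) t hi hj hij with h | h
    · exact h hs
    · rw [h] at h1
      linarith [hpos θ, hpos φ]
  have hker : LinearMap.ker (innerSL ℝ w).toLinearMap ≠ ⊤ := fun h => by
    have : w ∈ LinearMap.ker (innerSL ℝ w).toLinearMap := h ▸ Submodule.mem_top
    simp at this
    exact hw0 this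
  refine measure_mono_null (fun x hx => ?_) (Measure.addHaar_submodule volume _ hker)
  have h1 := hx.1.2 j
  have h2 := hx.2.2 i
  rw [Int.cast_natCast] at h1 h2
  have h3 : inner ℝ w x = 0 := by
    rw [hw, inner_sub_left, real_inner_smul_left, real_inner_smul_left, real_inner_comm,
      real_inner_comm x]
    linarith
  simpa using h3

/-- A point belongs to the sector whose index maximises the ratio of inner product to support value.
-/
theorem circumscribedPolygon_eq_iUnion (hpos : ∀ θ, 0 < supportAngle E θ) (hm : 2 ≤ m) (t : ℝ) :
    circumscribedPolygon E m t = ⋃ i ∈ Finset.range (2 * m), polygonSector E m t i := by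
  refine Subset.antisymm (fun x hx => ?_) (iUnion₂_subset fun i _ x hx => hx.1)
  obtain ⟨i, hi, hmax⟩ := (Finset.range (2 * m)).exists_max_image
    (fun i : ℕ => inner ℝ x (unitVec (t + i * (π / m))) / supportAngle E (t + i * (π / m)))
    ⟨0, by simp; omega⟩
  refine mem_iUnion₂.2 ⟨i, hi, hx, fun j => ?_⟩
  obtain ⟨k, hk, h1, h2⟩ := exists_range_of_int_index (by omega : 0 < m) E t j
  rw [h1, h2]
  have := hmax k hk
  rw [div_le_div_iff₀ (hpos _) (hpos _)] at this
  linarith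

theorem volume_circumscribedPolygon (hE : Bornology.IsBounded E) (hne : E.Nonempty)
    (hpos : ∀ θ, 0 < supportAngle E θ) (hm : 2 ≤ m) (t : ℝ) :
    volume (circumscribedPolygon E m t) = ENNReal.ofReal (∑ i ∈ Finset.range (2 * m),
      supportAngle E (t + i * (π / m)) * edgeLength E (π / m) (t + i * (π / m)) / 2) := by
  rw [circumscribedPolygon_eq_iUnion hpos hm, measure_biUnion_finset₀, ENNReal.ofReal_sum_of_nonneg]
  · exact Finset.sum_congr rfl fun i _ => (volume_polygonSector hE hne hpos hm t i).2
  · exact fun i _ => div_nonneg (mul_nonneg (hpos _).le (edgeLength_nonneg hE hne hm _)) two_pos.le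
  · intro i hi j hj hij
    exact volume_polygonSector_inter hpos hm t (by simpa using hi) (by simpa using hj) hij
  · exact fun i _ => (volume_polygonSector hE hne hpos hm t i).1.nullMeasurableSet

/-- Shift invariance identifies the integrals of p(θ) p(θ+δ) and p(θ) p(θ-δ); polarisation turns
them into a squared difference, which becomes ∫ p'² in the limit after scaling. -/
theorem integral_support_mul_edgeLength (hE : Bornology.IsBounded E) (δ : ℝ) :
    ∫ θ in 0..2 * π, supportAngle E θ * edgeLength E δ θ / 2 =
      ((2 - 2 * Real.cos δ) * (∫ θ in 0..2 * π, supportAngle E θ ^ 2) -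
        ∫ θ in 0..2 * π, (supportAngle E (θ + δ) - supportAngle E θ) ^ 2) / Real.sin δ / 2 := by
  obtain ⟨K, hK⟩ := supportAngle_lipschitz hE
  have hc := hK.continuous
  have hp := supportAngle_periodic E
  have hT : ∀ {g : ℝ → ℝ}, Continuous g → IntervalIntegrable g volume 0 (2 * π) :=
    fun hg => hg.intervalIntegrable _ _
  have h1 : ∫ θ in 0..2 * π, supportAngle E θ * supportAngle E (θ - δ) =
      ∫ θ in 0..2 * π, supportAngle E θ * supportAngle E (θ + δ) := by
    rw [← integral_period_comp_add (g := fun θ => supportAngle E θ * supportAngle E (θ - δ))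
      (fun θ => by simp only [hp θ, add_sub_right_comm, hp (θ - δ)]) δ]
    refine intervalIntegral.integral_congr fun θ _ => ?_
    simp only [add_sub_cancel_right]
    ring
  have h2 : ∫ θ in 0..2 * π, supportAngle E (θ + δ) ^ 2 = ∫ θ in 0..2 * π, supportAngle E θ ^ 2 :=
    integral_period_comp_add (g := fun θ => supportAngle E θ ^ 2)
      (fun θ => by simp only [hp θ]) δ
  have h3 : ∫ θ in 0..2 * π, (supportAngle E (θ + δ) - supportAngle E θ) ^ 2 =
      2 * (∫ θ in 0..2 * π, supportAngle E θ ^ 2) -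
        2 * ∫ θ in 0..2 * π, supportAngle E θ * supportAngle E (θ + δ) := by
    calc _ = ∫ θ in 0..2 * π, ((supportAngle E (θ + δ) ^ 2 + supportAngle E θ ^ 2) -
          2 * (supportAngle E θ * supportAngle E (θ + δ))) :=
          intervalIntegral.integral_congr fun θ _ => by ring
      _ = _ := by
        rw [intervalIntegral.integral_sub (hT (by fun_prop)) (hT (by fun_prop)),
          intervalIntegral.integral_add (hT (by fun_prop)) (hT (by fun_prop)), h2,
          intervalIntegral.integral_const_mul]
        ring
  have h4 : ∫ θ in 0..2 * π, supportAngle E θ * edgeLength E δ θ / 2 =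
      ∫ θ in 0..2 * π, ((supportAngle E θ * supportAngle E (θ + δ) +
        supportAngle E θ * supportAngle E (θ - δ)) - 2 * Real.cos δ * supportAngle E θ ^ 2) /
        Real.sin δ / 2 := by
    refine intervalIntegral.integral_congr fun θ _ => ?_
    simp only [edgeLength]
    ring
  rw [h4, intervalIntegral.integral_div, intervalIntegral.integral_div,
    intervalIntegral.integral_sub (hT (by fun_prop)) (hT (by fun_prop)),
    intervalIntegral.integral_add (hT (by fun_prop)) (hT (by fun_prop)), h1,
    intervalIntegral.integral_const_mul, h3]
  ring

/-- Dominated convergence: the quotients are bounded by the Lipschitz constant and converge wherever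
f is differentiable, hence almost everywhere. -/
theorem tendsto_integral_difference_quotient {f : ℝ → ℝ} {K : NNReal} (hf : LipschitzWith K f)
    (a b : ℝ) :
    Filter.Tendsto (fun m : ℕ => ∫ θ in a..b, ((f (θ + π / m) - f θ) / (π / m)) ^ 2)
      Filter.atTop (nhds (∫ θ in a..b, deriv f θ ^ 2)) := by
  have hc := hf.continuous
  refine intervalIntegral.tendsto_integral_filter_of_dominated_convergence (fun _ => (K : ℝ) ^ 2)
    (Filter.Eventually.of_forall fun m => Continuous.aestronglyMeasurable (by fun_prop)) ?_
    intervalIntegrable_const ?_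
  · refine Filter.Eventually.of_forall fun m => Filter.Eventually.of_forall fun θ _ => ?_
    rw [norm_pow]
    refine pow_le_pow_left₀ (norm_nonneg _) ?_ 2
    rw [norm_div]
    refine div_le_of_le_mul₀ (norm_nonneg _) K.coe_nonneg ?_
    simpa [Real.dist_eq] using hf.dist_le_mul (θ + π / m) θ
  · filter_upwards [hf.ae_differentiableAt_real] with θ hθ _
    refine Filter.Tendsto.pow ?_ 2
    have h0 : Filter.Tendsto (fun m : ℕ => π / m) Filter.atTop (nhdsWithin 0 {0}ᶜ) := by
      refine tendsto_nhdsWithin_iff.2 ⟨tendsto_pi_div_atTop, ?_⟩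
      filter_upwards [Filter.eventually_ge_atTop 1] with m hm
      have : 0 < π / m := by positivity
      exact this.ne'
    refine (hθ.hasDerivAt.tendsto_slope_zero.comp h0).congr fun m => ?_
    simp only [Function.comp_apply, smul_eq_mul]
    ring

theorem tendsto_div_sin :
    Filter.Tendsto (fun m : ℕ => π / m / Real.sin (π / m)) Filter.atTop (nhds 1) := by
  have hc : Filter.Tendsto (fun δ : ℝ => 1 / Real.sinc δ) (nhds 0) (nhds 1) := by
    have : ContinuousAt (fun δ : ℝ => 1 / Real.sinc δ) 0 :=
      ContinuousAt.div (by fun_prop) (by fun_prop) (by simp)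
    simpa [ContinuousAt] using this
  refine (hc.comp tendsto_pi_div_atTop).congr' ?_
  filter_upwards [Filter.eventually_ge_atTop 2] with m hm
  have : 0 < π / m := by positivity
  simp only [Function.comp_apply]
  rw [Real.sinc_of_ne_zero this.ne', one_div_div]

open scoped Pointwise in
/-- The area in terms of the support function, for compact convex sets with the origin in the
interior. -/
theorem area_eq_integral_of_pos (hE : Bornology.IsBounded E) (hc : Convex ℝ E)
    (hcl : IsClosed E) (hne : E.Nonempty) {r : ℝ} (hr : 0 < r)
    (hpos : ∀ θ, r ≤ supportAngle E θ) :
    area E = ((∫ θ in 0..2 * π, supportAngle E θ ^ 2) -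
      ∫ θ in 0..2 * π, deriv (supportAngle E) θ ^ 2) / 2 := by
  have hpos' : ∀ θ, 0 < supportAngle E θ := fun θ => hr.trans_le (hpos θ)
  obtain ⟨K, hK⟩ := supportAngle_lipschitz hE
  obtain ⟨C, hC0, hC⟩ := exists_circumscribedPolygon_subset_smul hE hc hne hr hpos
  rw [hcl.closure_eq] at hC
  have hfin : volume E ≠ ⊤ := hE.measure_lt_top.ne
  set g : ℝ → ℝ → ℝ := fun δ θ => supportAngle E θ * edgeLength E δ θ / 2 with hgdef
  have hg0 : ∀ m : ℕ, 3 ≤ m → ∀ t,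
      0 ≤ ∑ i ∈ Finset.range (2 * m), g (π / m) (t + i * (π / m)) :=
    fun m hm t => Finset.sum_nonneg fun i _ =>
      div_nonneg (mul_nonneg (hpos' _).le (edgeLength_nonneg hE hne (by omega) _)) two_pos.le
  have hup : ∀ m : ℕ, 3 ≤ m → ∀ t, area E ≤
      ∑ i ∈ Finset.range (2 * m), g (π / m) (t + i * (π / m)) := fun m hm t => by
    refine ENNReal.toReal_le_of_le_ofReal (hg0 m hm t) ?_
    rw [← volume_circumscribedPolygon hE hne hpos' (by omega) t]
    exact measure_mono (subset_circumscribedPolygon hE m t)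
  have hlow : ∀ m : ℕ, 3 ≤ m → ∀ t,
      ∑ i ∈ Finset.range (2 * m), g (π / m) (t + i * (π / m)) ≤
        (1 + C * (π / m)) ^ 2 * area E := fun m hm t => by
    have hη : 0 < 1 + C * (π / m) := by positivity
    have h := measure_mono (μ := volume) (hC m hm t)
    rw [volume_circumscribedPolygon hE hne hpos' (by omega) t, Measure.addHaar_smul,
      finrank_euclideanSpace_fin, abs_of_nonneg (by positivity), ← ENNReal.ofReal_toReal hfin,
      ← ENNReal.ofReal_mul (by positivity), ENNReal.ofReal_le_ofReal_iff (by positivity)] at h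
    exact h
  -- Averaging over t as for the perimeter; the dilation factor now enters squared.
  have hk : ∀ m : ℕ, 3 ≤ m → area E ≤ (∫ θ in 0..2 * π, g (π / m) θ) / (π / m) ∧
      (∫ θ in 0..2 * π, g (π / m) θ) / (π / m) ≤ (1 + C * (π / m)) ^ 2 * area E := fun m hm => by
    have hgc : Continuous (g (π / m)) := by
      have := continuous_edgeLength hE (π / m)
      have := hK.continuous
      fun_prop
    have h1 := mul_le_integral_of_le_sum_shift (by omega : 0 < m) hgc (hup m hm)
    have h2 := integral_le_mul_of_sum_shift_le (by omega : 0 < m) hgc (hlow m hm)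
    have hδ : 0 < π / m := by positivity
    rw [le_div_iff₀ hδ, div_le_iff₀ hδ]
    constructor <;> linarith
  have ht : Filter.Tendsto (fun m : ℕ => (∫ θ in 0..2 * π, g (π / m) θ) / (π / m)) Filter.atTop
      (nhds (((∫ θ in 0..2 * π, supportAngle E θ ^ 2) -
        ∫ θ in 0..2 * π, deriv (supportAngle E) θ ^ 2) / 2)) := by
    have h := ((tendsto_cos_div_sin.mul_const (∫ θ in 0..2 * π, supportAngle E θ ^ 2)).sub
      (tendsto_div_sin.mul (tendsto_integral_difference_quotient hK 0 (2 * π)))).div_const 2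
    rw [one_mul, one_mul] at h
    refine h.congr' ?_
    filter_upwards [Filter.eventually_ge_atTop 2] with m hm
    rw [integral_support_mul_edgeLength hE]
    have hδ : 0 < π / m := by positivity
    have hs := sin_pi_div_pos hm
    have e : ∫ θ in 0..2 * π, ((supportAngle E (θ + π / m) - supportAngle E θ) / (π / m)) ^ 2 =
        (∫ θ in 0..2 * π, (supportAngle E (θ + π / m) - supportAngle E θ) ^ 2) / (π / m) ^ 2 := by
      rw [← intervalIntegral.integral_div]
      exact intervalIntegral.integral_congr fun θ _ => div_pow _ _ 2
    rw [e]
    generalize π / (m : ℝ) = δ at hδ hs ⊢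
    field_simp
  have ht2 : Filter.Tendsto (fun m : ℕ => (1 + C * (π / m)) ^ 2 * area E) Filter.atTop
      (nhds (area E)) := by
    simpa using (((tendsto_pi_div_atTop.const_mul C).const_add 1).pow 2).mul_const (area E)
  refine le_antisymm (ge_of_tendsto ht ?_) (le_of_tendsto_of_tendsto ht ht2 ?_)
  · filter_upwards [Filter.eventually_ge_atTop 3] with m hm using (hk m hm).1
  · filter_upwards [Filter.eventually_ge_atTop 3] with m hm using (hk m hm).2

end

/-! ### Perimeter, area and curvature moment of a general planar convex set -/

theorem supportAngle_preimage_add {E : Set Plane} (hE : Bornology.IsBounded E) (hne : E.Nonempty)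
    (z : Plane) (θ : ℝ) : supportAngle ((fun x => x + z) ⁻¹' E) θ =
      supportAngle E θ - (z 0 * Real.cos θ + z 1 * Real.sin θ) := by
  have hF : Bornology.IsBounded ((fun x : Plane => x + z) ⁻¹' E) :=
    (IsometryEquiv.addRight z).isometry.antilipschitz.isBounded_preimage hE
  have hFne : ((fun x : Plane => x + z) ⁻¹' E).Nonempty := by
    obtain ⟨y, hy⟩ := hne
    exact ⟨y - z, by simpa using hy⟩
  rw [← inner_unitVec]
  refine le_antisymm (supportAngle_le hFne fun y hy => ?_) ?_
  · have := inner_le_supportAngle hE (subset_closure hy) θ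
    rw [inner_add_left] at this
    linarith
  · rw [sub_le_iff_le_add]
    refine supportAngle_le hne fun y hy => ?_
    have := inner_le_supportAngle hF (subset_closure (show y - z ∈ (fun x => x + z) ⁻¹' E by
      simpa using hy)) θ
    rw [inner_sub_left] at this
    linarith

theorem integral_sub_harmonic {f : ℝ → ℝ} (hf : Continuous f) (a b : ℝ) :
    ∫ θ in 0..2 * π, (f θ - (a * Real.cos θ + b * Real.sin θ)) = ∫ θ in 0..2 * π, f θ := by
  rw [intervalIntegral.integral_sub (hf.intervalIntegrable _ _)
    (Continuous.intervalIntegrable (by fun_prop) _ _), intervalIntegral.integral_add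
    (Continuous.intervalIntegrable (by fun_prop) _ _)
    (Continuous.intervalIntegrable (by fun_prop) _ _), intervalIntegral.integral_const_mul,
    intervalIntegral.integral_const_mul, integral_cos_period, integral_sin_period]
  ring

theorem frontier_closure_eq_of_convex {E : Set Plane} (hE : IsPlanarConvex E) :
    frontier (closure E) = frontier E := by
  rw [frontier, frontier, closure_closure,
    hE.convex.interior_closure_eq_interior_of_nonempty_interior hE.nonempty_interior]

theorem volume_closure_eq_of_convex {E : Set Plane} (hE : IsPlanarConvex E) :
    volume (closure E) = volume E := by
  refine le_antisymm ?_ (measure_mono subset_closure)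
  rw [closure_eq_self_union_frontier]
  refine (measure_union_le _ _).trans ?_
  rw [hE.convex.addHaar_frontier volume, add_zero]

/-- Translating an interior point to the origin and passing to the closure reduces to the positive
case. Frontier and area survive the closure by convexity. The translation adds a first harmonic to
p, which does not change ∫ p and changes ∫ p² and ∫ p'² by the same amount. -/
theorem perimeter_and_area_eq_integral {E : Set Plane} (hE : IsPlanarConvex E) :
    perimeter E = (∫ θ in 0..2 * π, supportAngle E θ) ∧
    area E = ((∫ θ in 0..2 * π, supportAngle E θ ^ 2) -
      ∫ θ in 0..2 * π, deriv (supportAngle E) θ ^ 2) / 2 := by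
  obtain ⟨z, hz⟩ := hE.nonempty_interior
  have hne : E.Nonempty := ⟨z, interior_subset hz⟩
  obtain ⟨K, hK⟩ := supportAngle_lipschitz hE.isBounded
  have hp := supportAngle_periodic E
  set F : Set Plane := (fun x => x + z) ⁻¹' closure E with hF
  have hFb : Bornology.IsBounded F :=
    (IsometryEquiv.addRight z).isometry.antilipschitz.isBounded_preimage hE.isBounded.closure
  have hFc : Convex ℝ F := hE.convex.closure.translate_preimage_right z |> fun h => by
    simpa [hF, add_comm] using h
  have hFcl : IsClosed F := isClosed_closure.preimage (by fun_prop)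
  have h0 : (0 : Plane) ∈ interior F := by
    refine mem_interior.2 ⟨(fun x => x + z) ⁻¹' interior E, fun x hx =>
      subset_closure (interior_subset hx), isOpen_interior.preimage (by fun_prop), ?_⟩
    simpa using hz
  have hsupp : supportAngle F =
      fun θ => supportAngle E θ - (z 0 * Real.cos θ + z 1 * Real.sin θ) := by
    funext θ
    rw [hF, supportAngle_preimage_add hE.isBounded.closure hne.closure,
      supportAngle_closure hE.isBounded hne]
  obtain ⟨r, hr, hball⟩ := Metric.isOpen_iff.1 isOpen_interior 0 h0
  have hpos : ∀ θ, r / 2 ≤ supportAngle F θ := fun θ => by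
    have hm : (r / 2) • unitVec θ ∈ F := interior_subset (hball (by
      simp [norm_smul, norm_unitVec, abs_of_pos hr, hr]))
    have := inner_le_supportAngle hFb (subset_closure hm) θ
    rwa [real_inner_smul_left, real_inner_self_eq_norm_sq, norm_unitVec, one_pow, mul_one] at this
  have hP : perimeter E = perimeter F := by
    have : frontier F = (IsometryEquiv.addRight z) ⁻¹' frontier E := by
      rw [← frontier_closure_eq_of_convex hE]
      exact ((IsometryEquiv.addRight z).toHomeomorph.preimage_frontier (closure E)).symm
    rw [perimeter, perimeter, this, IsometryEquiv.hausdorffMeasure_preimage]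
  have hA : area E = area F := by
    rw [area, area, hF, measure_preimage_add_right, volume_closure_eq_of_convex hE]
  rw [hP, hA, perimeter_eq_integral_of_pos hFb hFc hFcl ⟨0, h0⟩ (half_pos hr) hpos,
    area_eq_integral_of_pos hFb hFc hFcl ⟨0, interior_subset h0⟩ (half_pos hr) hpos, hsupp,
    integral_sub_harmonic hK.continuous, integral_sq_deriv_sub_harmonic hK hp]
  have h := integral_sq_sub_harmonic_of_continuous hK.continuous 0 (z 0) (z 1)
  simp only [zero_add] at h
  rw [h]
  refine ⟨rfl, ?_⟩
  ring

/-! ### Discs -/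

theorem closure_eq_closedBall_of_supportAngle {E : Set Plane} (hE : IsPlanarConvex E) {r : ℝ}
    {c : Plane} (h : ∀ θ, supportAngle E θ = r + (c 0 * Real.cos θ + c 1 * Real.sin θ)) :
    closure E = Metric.closedBall c r := by
  have hne := hE.nonempty_interior.mono interior_subset
  ext x
  rw [mem_closure_iff_inner_le_supportAngle hE.isBounded hE.convex hne, mem_closedBall_iff_norm]
  simp only [h, ← inner_unitVec]
  constructor
  · intro hx
    obtain ⟨θ, hθ⟩ := exists_eq_norm_smul_unitVec (x - c)
    have h1 : inner ℝ (x - c) (unitVec θ) = ‖x - c‖ := by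
      conv_lhs => rw [hθ, real_inner_smul_left, real_inner_self_eq_norm_sq, norm_unitVec]
      simp
    rw [inner_sub_left] at h1
    linarith [hx θ]
  · intro hx θ
    have h1 := real_inner_le_norm (x - c) (unitVec θ)
    rw [norm_unitVec, mul_one, inner_sub_left] at h1
    linarith

theorem interior_eq_ball_iff_supportAngle {E : Set Plane} (hE : IsPlanarConvex E) {r : ℝ}
    {c : Plane} : (0 < r ∧ interior E = Metric.ball c r) ↔
      ∀ θ, supportAngle E θ = r + (c 0 * Real.cos θ + c 1 * Real.sin θ) := by
  have hne := hE.nonempty_interior.mono interior_subset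
  constructor
  · rintro ⟨hr, hi⟩ θ
    have hcl : closure E = Metric.closedBall c r := by
      rw [← hE.convex.closure_interior_eq_closure_of_nonempty_interior hE.nonempty_interior, hi,
        closure_ball c hr.ne']
    rw [← inner_unitVec]
    refine le_antisymm (supportAngle_le hne fun y hy => ?_) ?_
    · have hy' : y ∈ Metric.closedBall c r := hcl ▸ subset_closure hy
      have h1 := real_inner_le_norm (y - c) (unitVec θ)
      rw [norm_unitVec, mul_one, inner_sub_left] at h1
      linarith [mem_closedBall_iff_norm.1 hy']
    · have hm : c + r • unitVec θ ∈ closure E := by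
        rw [hcl, mem_closedBall_iff_norm, add_sub_cancel_left, norm_smul, norm_unitVec, mul_one,
          Real.norm_of_nonneg hr.le]
      have h1 := inner_le_supportAngle hE.isBounded hm θ
      rw [inner_add_left, real_inner_smul_left, real_inner_self_eq_norm_sq, norm_unitVec] at h1
      linarith
  · intro h
    -- The strict bounds at the opposite angles 0 and π add up to 0 < 2r.
    have hr : 0 < r := by
      obtain ⟨z, hz⟩ := hE.nonempty_interior
      have h1 := inner_lt_supportAngle_of_mem_interior hE.isBounded hz 0
      have h2 := inner_lt_supportAngle_of_mem_interior hE.isBounded hz π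
      rw [h, inner_unitVec] at h1 h2
      simp at h1 h2
      linarith
    refine ⟨hr, ?_⟩
    rw [← hE.convex.interior_closure_eq_interior_of_nonempty_interior hE.nonempty_interior,
      closure_eq_closedBall_of_supportAngle hE h, interior_closedBall c hr.ne']

/-! ### Convex sets with support function `1 + ε cos (kθ)` -/

theorem abs_sin_nat_mul_le (k : ℕ) (x : ℝ) : |Real.sin (k * x)| ≤ k * |Real.sin x| := by
  induction k with
  | zero => simp
  | succ k ih =>
    have e : ((k + 1 : ℕ) : ℝ) * x = k * x + x := by push_cast; ring
    rw [e, Real.sin_add]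
    have h1 : |Real.sin (k * x) * Real.cos x| ≤ |Real.sin (k * x)| := by
      rw [abs_mul]
      exact mul_le_of_le_one_right (abs_nonneg _) (Real.abs_cos_le_one x)
    have h2 : |Real.cos (k * x) * Real.sin x| ≤ |Real.sin x| := by
      rw [abs_mul]
      exact mul_le_of_le_one_left (abs_nonneg _) (Real.abs_cos_le_one _)
    push_cast
    linarith [abs_add_le (Real.sin (k * x) * Real.cos x) (Real.cos (k * x) * Real.sin x)]

theorem one_sub_cos_eq (x : ℝ) : 1 - Real.cos x = 2 * |Real.sin (x / 2)| ^ 2 := by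
  have h := Real.cos_two_mul' (x / 2)
  rw [mul_div_cancel₀ x (two_ne_zero' ℝ)] at h
  rw [sq_abs]
  linarith [Real.cos_sq_add_sin_sq (x / 2)]

theorem one_sub_cos_nat_mul_le (k : ℕ) (x : ℝ) :
    1 - Real.cos (k * x) ≤ k ^ 2 * (1 - Real.cos x) := by
  rw [one_sub_cos_eq, one_sub_cos_eq, mul_div_assoc]
  have := pow_le_pow_left₀ (abs_nonneg _) (abs_sin_nat_mul_le k (x / 2)) 2
  rw [mul_pow] at this
  linarith

/-- The slack in `support_inequality_cos` is a multiple of 1 - cos x, which vanishes at x = 0, so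
the error must be bounded by that quantity and not by a constant. -/
theorem abs_nat_mul_sin_sub_sin_le (k : ℕ) (x : ℝ) :
    |k * Real.sin x - Real.sin (k * x)| ≤ k * (1 + k ^ 2) * (1 - Real.cos x) := by
  have h0 : 0 ≤ 1 - Real.cos x := sub_nonneg.2 (Real.cos_le_one x)
  induction k with
  | zero => simp
  | succ k ih =>
    have e : ((k + 1 : ℕ) : ℝ) * Real.sin x - Real.sin (((k + 1 : ℕ) : ℝ) * x) =
        (k * Real.sin x - Real.sin (k * x)) + (Real.sin (k * x) * (1 - Real.cos x) +
          Real.sin x * (1 - Real.cos (k * x))) := by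
      have e' : ((k + 1 : ℕ) : ℝ) * x = k * x + x := by push_cast; ring
      rw [e', Real.sin_add]
      push_cast
      ring
    have h1 : |Real.sin (k * x) * (1 - Real.cos x)| ≤ 1 - Real.cos x := by
      rw [abs_mul, abs_of_nonneg h0]
      exact mul_le_of_le_one_left h0 (Real.abs_sin_le_one _)
    have h2 : |Real.sin x * (1 - Real.cos (k * x))| ≤ k ^ 2 * (1 - Real.cos x) := by
      rw [abs_mul, abs_of_nonneg (sub_nonneg.2 (Real.cos_le_one _))]
      exact (mul_le_of_le_one_left (sub_nonneg.2 (Real.cos_le_one _))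
        (Real.abs_sin_le_one _)).trans (one_sub_cos_nat_mul_le k x)
    have h3 := abs_add_le (Real.sin (k * x) * (1 - Real.cos x))
      (Real.sin x * (1 - Real.cos (k * x)))
    have h4 := abs_add_le (k * Real.sin x - Real.sin (k * x))
      (Real.sin (k * x) * (1 - Real.cos x) + Real.sin x * (1 - Real.cos (k * x)))
    rw [e]
    have h5 : (k : ℝ) * (1 + k ^ 2) * (1 - Real.cos x) + (1 - Real.cos x) +
        k ^ 2 * (1 - Real.cos x) ≤
        ((k + 1 : ℕ) : ℝ) * (1 + ((k + 1 : ℕ) : ℝ) ^ 2) * (1 - Real.cos x) := by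
      have : (k : ℝ) * (1 + k ^ 2) + 1 + k ^ 2 ≤
        ((k + 1 : ℕ) : ℝ) * (1 + ((k + 1 : ℕ) : ℝ) ^ 2) := by
        push_cast
        nlinarith [(Nat.cast_nonneg k : (0 : ℝ) ≤ k)]
      linarith [mul_le_mul_of_nonneg_right this h0]
    linarith

/-- The perturbed disc whose support function is `1 + ε cos (kθ)`, for small `ε`. -/
def perturbedDisc (k : ℕ) (ε : ℝ) : Set Plane :=
  {x | ∀ θ, inner ℝ x (unitVec θ) ≤ 1 + ε * Real.cos (k * θ)}

section

variable {k : ℕ} {ε : ℝ}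

/-- The boundary point p u + p' u' built from p = 1 + ε cos kθ meets every constraint. With φ = θ +
α the slack is (1 - cos α) + ε (cos kθ (cos kα - cos α) + sin kθ (k sin α - sin kα)). The bracket is
at least -(k+1)(1+k²)(1 - cos α), which explains the smallness condition on ε. -/
theorem support_inequality_cos (hε : 0 ≤ ε) (hk : ε * ((k + 1) * (1 + k ^ 2)) ≤ 1) (θ φ : ℝ) :
    (1 + ε * Real.cos (k * θ)) * Real.cos (φ - θ) +
      -(ε * (k * Real.sin (k * θ))) * Real.sin (φ - θ) ≤ 1 + ε * Real.cos (k * φ) := by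
  obtain ⟨α, rfl⟩ : ∃ α, φ = θ + α := ⟨φ - θ, by ring⟩
  rw [add_sub_cancel_left, mul_add, Real.cos_add]
  have h0 : 0 ≤ 1 - Real.cos α := sub_nonneg.2 (Real.cos_le_one α)
  have h1 := one_sub_cos_nat_mul_le k α
  have h2 := abs_nat_mul_sin_sub_sin_le k α
  have h3 : |Real.cos (k * θ) * (Real.cos (k * α) - Real.cos α)| ≤
      (k ^ 2 + 1) * (1 - Real.cos α) := by
    rw [abs_mul]
    refine (mul_le_of_le_one_left (abs_nonneg _) (Real.abs_cos_le_one _)).trans ?_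
    rw [abs_le]
    constructor
    · nlinarith
    · nlinarith [Real.cos_le_one (k * α)]
  have h4 : |Real.sin (k * θ) * (k * Real.sin α - Real.sin (k * α))| ≤
      k * (1 + k ^ 2) * (1 - Real.cos α) := by
    rw [abs_mul]
    exact (mul_le_of_le_one_left (abs_nonneg _) (Real.abs_sin_le_one _)).trans h2
  have h5 := mul_le_mul_of_nonneg_left (add_le_add (abs_le.1 h3).1 (abs_le.1 h4).1) hε
  have h6 := mul_le_mul_of_nonneg_right hk h0
  linarith

theorem isPlanarConvex_perturbedDisc (hε : 0 ≤ ε) (hε2 : ε ≤ 1 / 2) :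
    IsPlanarConvex (perturbedDisc k ε) := by
  have hcos : ∀ θ, 1 / 2 ≤ 1 + ε * Real.cos (k * θ) ∧ 1 + ε * Real.cos (k * θ) ≤ 3 / 2 :=
    fun θ => by
      have h1 := Real.neg_one_le_cos (k * θ)
      have h2 := Real.cos_le_one (k * θ)
      constructor <;> nlinarith
  refine ⟨?_, ?_, ?_⟩
  · simp only [perturbedDisc, Set.ofPred_forall]
    exact convex_iInter fun θ => convex_halfspace_unitVec _ _
  · refine isBounded_iff_forall_norm_le.2 ⟨3 / 2, fun x hx => ?_⟩
    obtain ⟨θ, hθ⟩ := exists_eq_norm_smul_unitVec x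
    have h1 : inner ℝ x (unitVec θ) = ‖x‖ := by
      conv_lhs => rw [hθ, real_inner_smul_left, real_inner_self_eq_norm_sq, norm_unitVec]
      simp
    rw [← h1]
    exact (hx θ).trans (hcos θ).2
  · refine ⟨0, mem_interior.2 ⟨Metric.ball 0 (1 / 2), fun x hx θ => ?_, Metric.isOpen_ball,
      Metric.mem_ball_self (by norm_num)⟩⟩
    have h1 := real_inner_le_norm x (unitVec θ)
    rw [norm_unitVec, mul_one] at h1
    linarith [mem_ball_zero_iff.1 hx, (hcos θ).1]

theorem supportAngle_perturbedDisc (hε : 0 ≤ ε) (hε2 : ε ≤ 1 / 2)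
    (hk : ε * ((k + 1) * (1 + k ^ 2)) ≤ 1) :
    supportAngle (perturbedDisc k ε) = fun θ => 1 + ε * Real.cos (k * θ) := by
  have hE := isPlanarConvex_perturbedDisc (k := k) hε hε2
  funext θ
  refine le_antisymm (supportAngle_le (hE.nonempty_interior.mono interior_subset)
    fun y hy => hy θ) ?_
  have hm : (1 + ε * Real.cos (k * θ)) • unitVec θ +
      (-(ε * (k * Real.sin (k * θ)))) • unitVec (θ + π / 2) ∈ perturbedDisc k ε := fun φ => by
    rw [inner_frame]
    exact support_inequality_cos hε hk θ φ
  have h := inner_le_supportAngle hE.isBounded (subset_closure hm) θ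
  rw [inner_frame] at h
  simpa using h

end

theorem integral_cos_nat_mul {k : ℕ} (hk : k ≠ 0) : ∫ θ in 0..2 * π, Real.cos (k * θ) = 0 := by
  have h := integral_deriv_mul_periodic (lipschitzWith_sin_mul k) (LipschitzWith.const (1 : ℝ))
    (by simpa using periodic_sin_mul k) (fun _ => rfl)
  simp only [(hasDerivAt_sin_mul k _).deriv, deriv_const, mul_one, mul_zero,
    intervalIntegral.integral_const_mul, intervalIntegral.integral_zero, neg_zero] at h
  exact (mul_eq_zero.1 h).resolve_left (by exact_mod_cast hk)

theorem integral_cos_nat_mul_sq {k : ℕ} (hk : k ≠ 0) :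
    ∫ θ in 0..2 * π, Real.cos (k * θ) ^ 2 = π := by
  have e : ∀ θ : ℝ, Real.cos (k * θ) ^ 2 = 1 / 2 + 1 / 2 * Real.cos ((2 * k : ℕ) * θ) :=
    fun θ => by
      rw [Real.cos_sq]
      push_cast
      ring_nf
  simp_rw [e]
  rw [intervalIntegral.integral_add intervalIntegrable_const
    (Continuous.intervalIntegrable (by fun_prop) _ _), intervalIntegral.integral_const_mul,
    integral_cos_nat_mul (by omega)]
  simp
  ring

theorem integral_sin_nat_mul_sq {k : ℕ} (hk : k ≠ 0) :
    ∫ θ in 0..2 * π, Real.sin (k * θ) ^ 2 = π := by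
  simp_rw [Real.sin_sq]
  rw [intervalIntegral.integral_sub intervalIntegrable_const
    (Continuous.intervalIntegrable (by fun_prop) _ _), integral_cos_nat_mul_sq hk]
  simp
  ring

/-- Integrating by parts twice multiplies the integral by k² on one side and by 1 on the other, and
k² ≠ 1. -/
theorem integral_cos_nat_mul_harmonic {k : ℕ} (hk : 2 ≤ k) :
    (∫ θ in 0..2 * π, Real.cos (k * θ) * Real.cos θ = 0) ∧
      ∫ θ in 0..2 * π, Real.cos (k * θ) * Real.sin θ = 0 := by
  have hc := lipschitzWith_cos_mul (k : ℝ)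
  have hs := lipschitzWith_sin_mul (k : ℝ)
  have pc : Function.Periodic (fun y : ℝ => Real.cos (k * y)) (2 * π) := by
    simpa using periodic_cos_mul k
  have ps : Function.Periodic (fun y : ℝ => Real.sin (k * y)) (2 * π) := by
    simpa using periodic_sin_mul k
  have h1 := integral_deriv_mul_cos hc pc 1
  have h2 := integral_deriv_mul_sin hc pc 1
  have h3 := integral_deriv_mul_cos hs ps 1
  have h4 := integral_deriv_mul_sin hs ps 1
  simp only [(hasDerivAt_cos_mul (k : ℝ) _).deriv, (hasDerivAt_sin_mul (k : ℝ) _).deriv,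
    Int.cast_one, one_mul, neg_mul, mul_assoc, intervalIntegral.integral_neg,
    intervalIntegral.integral_const_mul] at h1 h2 h3 h4
  have hk2 : (2 : ℝ) ≤ k := by exact_mod_cast hk
  have hk' : (k : ℝ) ^ 2 - 1 ≠ 0 := by nlinarith
  constructor
  · refine (mul_eq_zero.1 ?_).resolve_left hk'
    linear_combination k * h3 - h2
  · refine (mul_eq_zero.1 ?_).resolve_left hk'
    linear_combination k * h4 + h1

/-! ### Energies of the support function -/

/-- The squared norm of the first harmonics of the support function. -/
noncomputable def firstHarmonicEnergy (E : Set Plane) : ℝ :=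
  ((∫ θ in 0..2 * π, supportAngle E θ * Real.cos θ) ^ 2 +
    (∫ θ in 0..2 * π, supportAngle E θ * Real.sin θ) ^ 2) / π

/-- The squared norm of the harmonics of order at least two of the support function. -/
noncomputable def higherHarmonicEnergy (E : Set Plane) : ℝ :=
  (∫ θ in 0..2 * π, supportAngle E θ ^ 2) - (∫ θ in 0..2 * π, supportAngle E θ) ^ 2 / (2 * π) -
    firstHarmonicEnergy E

/-- The squared norm of the harmonics of order at least two of the derivative of the support
function. -/
noncomputable def higherDerivEnergy (E : Set Plane) : ℝ :=
  (∫ θ in 0..2 * π, deriv (supportAngle E) θ ^ 2) - firstHarmonicEnergy E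

section

variable {E : Set Plane}

theorem firstHarmonicEnergy_nonneg (E : Set Plane) : 0 ≤ firstHarmonicEnergy E := by
  unfold firstHarmonicEnergy
  positivity

/-- Completing the square: `higherHarmonicEnergy` is the squared distance from p to the span of 1,
cos and sin, which yields both its sign and the case of vanishing. -/
theorem integral_sq_sub_eq_higherHarmonicEnergy (hE : Bornology.IsBounded E) (m a b : ℝ) :
    ∫ θ in 0..2 * π, (supportAngle E θ - (m + (a * Real.cos θ + b * Real.sin θ))) ^ 2 =
      higherHarmonicEnergy E + 2 * π * (m - (∫ θ in 0..2 * π, supportAngle E θ) / (2 * π)) ^ 2 +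
      π * ((a - (∫ θ in 0..2 * π, supportAngle E θ * Real.cos θ) / π) ^ 2 +
        (b - (∫ θ in 0..2 * π, supportAngle E θ * Real.sin θ) / π) ^ 2) := by
  obtain ⟨K, hK⟩ := supportAngle_lipschitz hE
  rw [integral_sq_sub_harmonic_of_continuous hK.continuous, higherHarmonicEnergy,
    firstHarmonicEnergy]
  field_simp
  ring

theorem higherHarmonicEnergy_nonneg (hE : Bornology.IsBounded E) : 0 ≤ higherHarmonicEnergy E := by
  have h := integral_sq_sub_eq_higherHarmonicEnergy hE
    ((∫ θ in 0..2 * π, supportAngle E θ) / (2 * π))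
    ((∫ θ in 0..2 * π, supportAngle E θ * Real.cos θ) / π)
    ((∫ θ in 0..2 * π, supportAngle E θ * Real.sin θ) / π)
  simp only [sub_self] at h
  have h0 : 0 ≤ ∫ θ in 0..2 * π, (supportAngle E θ -
      ((∫ θ in 0..2 * π, supportAngle E θ) / (2 * π) +
      ((∫ θ in 0..2 * π, supportAngle E θ * Real.cos θ) / π * Real.cos θ +
      (∫ θ in 0..2 * π, supportAngle E θ * Real.sin θ) / π * Real.sin θ))) ^ 2 :=
    intervalIntegral.integral_nonneg Real.two_pi_pos.le fun θ _ => sq_nonneg _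
  rw [h] at h0
  linarith

/-- On multiplying by 2π the first harmonics enter with weight 8 on the left and 2 on the right; the
difference is the 6 of `four_mul_integral_sq_le`. -/
theorem four_mul_higherHarmonicEnergy_le (hE : Bornology.IsBounded E) :
    4 * higherHarmonicEnergy E ≤ higherDerivEnergy E := by
  obtain ⟨K, hK⟩ := supportAngle_lipschitz hE
  have h := four_mul_integral_sq_le hK (supportAngle_periodic E)
  refine le_of_mul_le_mul_left ?_ Real.two_pi_pos
  have e1 : 2 * π * (4 * higherHarmonicEnergy E) =
      4 * (2 * π * ∫ θ in 0..2 * π, supportAngle E θ ^ 2) -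
        4 * (∫ θ in 0..2 * π, supportAngle E θ) ^ 2 -
        8 * ((∫ θ in 0..2 * π, supportAngle E θ * Real.cos θ) ^ 2 +
          (∫ θ in 0..2 * π, supportAngle E θ * Real.sin θ) ^ 2) := by
    rw [higherHarmonicEnergy, firstHarmonicEnergy]
    field_simp
    ring
  have e2 : 2 * π * higherDerivEnergy E =
      2 * π * (∫ θ in 0..2 * π, deriv (supportAngle E) θ ^ 2) -
        2 * ((∫ θ in 0..2 * π, supportAngle E θ * Real.cos θ) ^ 2 +
          (∫ θ in 0..2 * π, supportAngle E θ * Real.sin θ) ^ 2) := by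
    rw [higherDerivEnergy, firstHarmonicEnergy]
    field_simp
  rw [e1, e2]
  linarith

theorem supportAngle_eq_of_higherHarmonicEnergy_eq_zero (hE : Bornology.IsBounded E)
    (h0 : higherHarmonicEnergy E = 0) (θ : ℝ) :
    supportAngle E θ = (∫ θ in 0..2 * π, supportAngle E θ) / (2 * π) +
      ((∫ θ in 0..2 * π, supportAngle E θ * Real.cos θ) / π * Real.cos θ +
      (∫ θ in 0..2 * π, supportAngle E θ * Real.sin θ) / π * Real.sin θ) := by
  obtain ⟨K, hK⟩ := supportAngle_lipschitz hE
  have hc := hK.continuous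
  have h := integral_sq_sub_eq_higherHarmonicEnergy hE
    ((∫ θ in 0..2 * π, supportAngle E θ) / (2 * π))
    ((∫ θ in 0..2 * π, supportAngle E θ * Real.cos θ) / π)
    ((∫ θ in 0..2 * π, supportAngle E θ * Real.sin θ) / π)
  simp only [sub_self, h0] at h
  rw [zero_pow two_ne_zero, mul_zero, add_zero, zero_add, mul_zero] at h
  refine sub_eq_zero.1 (eq_zero_of_integral_sq_eq_zero (by fun_prop) (fun x => ?_) h θ)
  simp only [supportAngle_periodic E x, Real.cos_periodic x, Real.sin_periodic x]

/-- The residual is zero, yet equals `higherHarmonicEnergy` plus nonnegative squares, so each of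
these vanishes and the coefficients are determined. -/
theorem energies_of_supportAngle_eq (hE : Bornology.IsBounded E) {r a b : ℝ}
    (h : ∀ θ, supportAngle E θ = r + (a * Real.cos θ + b * Real.sin θ)) :
    higherHarmonicEnergy E = 0 ∧ higherDerivEnergy E = 0 ∧
      firstHarmonicEnergy E = π * (a ^ 2 + b ^ 2) := by
  obtain ⟨K, hK⟩ := supportAngle_lipschitz hE
  have h1 := integral_sq_sub_eq_higherHarmonicEnergy hE r a b
  have h2 := integral_deriv_sq_sub_harmonic hK (supportAngle_periodic E) a b
  have hd : ∀ θ, deriv (supportAngle E) θ = -a * Real.sin θ + b * Real.cos θ := fun θ => by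
    have h' : HasDerivAt (fun θ => r + (a * Real.cos θ + b * Real.sin θ))
        (a * -Real.sin θ + b * Real.cos θ) θ :=
      (((Real.hasDerivAt_cos θ).const_mul a).add ((Real.hasDerivAt_sin θ).const_mul b)).const_add r
    rw [funext h, h'.deriv]
    ring
  have z1 : ∫ θ in 0..2 * π,
      (supportAngle E θ - (r + (a * Real.cos θ + b * Real.sin θ))) ^ 2 = 0 := by
    simp only [h, sub_self]
    simp
  have z2 : ∫ θ in 0..2 * π,
      (deriv (supportAngle E) θ - (-a * Real.sin θ + b * Real.cos θ)) ^ 2 = 0 := by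
    simp only [hd, sub_self]
    simp
  rw [z1] at h1
  rw [z2] at h2
  have hW := higherHarmonicEnergy_nonneg hE
  unfold higherDerivEnergy firstHarmonicEnergy
  set A := ∫ θ in 0..2 * π, supportAngle E θ * Real.cos θ
  set B := ∫ θ in 0..2 * π, supportAngle E θ * Real.sin θ
  have p1 : 0 ≤ 2 * π * (r - (∫ θ in 0..2 * π, supportAngle E θ) / (2 * π)) ^ 2 := by positivity
  have p2 : 0 ≤ π * ((a - A / π) ^ 2 + (b - B / π) ^ 2) := by positivity
  have p3 := (mul_eq_zero.1 (by linarith :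
    π * ((a - A / π) ^ 2 + (b - B / π) ^ 2) = 0)).resolve_left Real.pi_ne_zero
  obtain ⟨hA, hB⟩ := (add_eq_zero_iff_of_nonneg (sq_nonneg _) (sq_nonneg _)).1 p3
  rw [pow_eq_zero_iff two_ne_zero, sub_eq_zero, eq_div_iff Real.pi_ne_zero] at hA hB
  have hV : (A ^ 2 + B ^ 2) / π = π * (a ^ 2 + b ^ 2) := by
    rw [← hA, ← hB]
    field_simp
  refine ⟨by linarith, ?_, hV⟩
  rw [hV]
  rw [← hA, ← hB] at h2
  linarith

/-- The moment contains ∫ p² + ∫ p'² and 2β times the area contributes β (∫ p² - ∫ p'²), hence the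
weights 1 + β and 1 - β. The first harmonics combine with x₀ into a complete square. -/
theorem curvatureMoment_eq_energies (hE : IsPlanarConvex E) (β : ℝ) (x₀ : Plane) :
    curvatureMoment E hE.isBounded x₀ + 2 * β * area E =
      (1 + β) * (perimeter E ^ 2 / (2 * π)) + (1 + β) * higherHarmonicEnergy E +
        (1 - β) * higherDerivEnergy E +
      2 * π * ((x₀ 0 - (∫ θ in 0..2 * π, supportAngle E θ * Real.cos θ) / π) ^ 2 +
        (x₀ 1 - (∫ θ in 0..2 * π, supportAngle E θ * Real.sin θ) / π) ^ 2) := by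
  rw [curvatureMoment_eq hE.isBounded (hE.nonempty_interior.mono interior_subset),
    (perimeter_and_area_eq_integral hE).1, (perimeter_and_area_eq_integral hE).2,
    higherHarmonicEnergy, higherDerivEnergy, firstHarmonicEnergy]
  field_simp
  ring

theorem iInf_curvatureMoment_eq_energies (hE : IsPlanarConvex E) (β : ℝ) :
    (⨅ x₀ : Plane, curvatureMoment E hE.isBounded x₀) + 2 * β * area E =
      (1 + β) * (perimeter E ^ 2 / (2 * π)) + (1 + β) * higherHarmonicEnergy E +
        (1 - β) * higherDerivEnergy E := by
  -- The Steiner point, where the square in x₀ vanishes.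
  set c : Plane := !₂[(∫ θ in 0..2 * π, supportAngle E θ * Real.cos θ) / π,
    (∫ θ in 0..2 * π, supportAngle E θ * Real.sin θ) / π] with hc
  have hval := curvatureMoment_eq_energies hE β c
  have hmin : ∀ x, curvatureMoment E hE.isBounded c ≤ curvatureMoment E hE.isBounded x := by
    intro x
    have h := curvatureMoment_eq_energies hE β x
    have h0 : 0 ≤ 2 * π * ((x 0 - (∫ θ in 0..2 * π, supportAngle E θ * Real.cos θ) / π) ^ 2 +
        (x 1 - (∫ θ in 0..2 * π, supportAngle E θ * Real.sin θ) / π) ^ 2) := by positivity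
    simp [hc] at hval
    linarith
  have hinf : ⨅ x₀ : Plane, curvatureMoment E hE.isBounded x₀ =
      curvatureMoment E hE.isBounded c :=
    le_antisymm (ciInf_le ⟨_, by rintro _ ⟨x, rfl⟩; exact hmin x⟩ c) (le_ciInf hmin)
  rw [hinf, hval]
  simp [hc]

theorem integral_norm_sq_eq_energies (hE : IsPlanarConvex E) (β : ℝ) :
    (∫ x, ‖x‖ ^ 2 ∂(curvatureMeasure E hE.isBounded)) + 2 * β * area E =
      (1 + β) * (perimeter E ^ 2 / (2 * π)) + (1 + β) * higherHarmonicEnergy E +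
        (1 - β) * higherDerivEnergy E + 2 * firstHarmonicEnergy E := by
  have h := curvatureMoment_eq_energies hE β 0
  simp only [curvatureMoment, sub_zero, PiLp.zero_apply, zero_sub] at h
  rw [h, firstHarmonicEnergy]
  field_simp

theorem higherHarmonicEnergy_eq_zero_iff (hE : IsPlanarConvex E) :
    higherHarmonicEnergy E = 0 ↔ ∃ (r : ℝ) (c : Plane), 0 < r ∧ interior E = Metric.ball c r := by
  constructor
  · intro h0
    exact ⟨_, !₂[(∫ θ in 0..2 * π, supportAngle E θ * Real.cos θ) / π,
      (∫ θ in 0..2 * π, supportAngle E θ * Real.sin θ) / π],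
      (interior_eq_ball_iff_supportAngle hE).2 fun θ =>
        supportAngle_eq_of_higherHarmonicEnergy_eq_zero hE.isBounded h0 θ⟩
  · rintro ⟨r, c, h⟩
    exact (energies_of_supportAngle_eq hE.isBounded
      ((interior_eq_ball_iff_supportAngle hE).1 h)).1

theorem energies_eq_zero_iff_centered_disc (hE : IsPlanarConvex E) :
    (higherHarmonicEnergy E = 0 ∧ firstHarmonicEnergy E = 0) ↔
      ∃ r : ℝ, 0 < r ∧ interior E = Metric.ball 0 r := by
  constructor
  · rintro ⟨h0, h1⟩
    have h2 := supportAngle_eq_of_higherHarmonicEnergy_eq_zero hE.isBounded h0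
    have h3 := (div_eq_zero_iff.1 h1).resolve_right Real.pi_ne_zero
    obtain ⟨hA, hB⟩ := (add_eq_zero_iff_of_nonneg (sq_nonneg _) (sq_nonneg _)).1 h3
    rw [pow_eq_zero_iff two_ne_zero] at hA hB
    refine ⟨(∫ θ in 0..2 * π, supportAngle E θ) / (2 * π),
      (interior_eq_ball_iff_supportAngle hE).2 fun θ => ?_⟩
    rw [h2 θ, hA, hB]
    simp
  · rintro ⟨r, h⟩
    have := energies_of_supportAngle_eq hE.isBounded
      ((interior_eq_ball_iff_supportAngle hE).1 h)
    refine ⟨this.1, ?_⟩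
    rw [this.2.2]
    simp

theorem energies_perturbedDisc {k : ℕ} {ε : ℝ} (hk : 2 ≤ k) (hε : 0 ≤ ε) (hε2 : ε ≤ 1 / 2)
    (hkε : ε * ((k + 1) * (1 + k ^ 2)) ≤ 1) :
    firstHarmonicEnergy (perturbedDisc k ε) = 0 ∧
      higherHarmonicEnergy (perturbedDisc k ε) = π * ε ^ 2 ∧
      higherDerivEnergy (perturbedDisc k ε) = k ^ 2 * (π * ε ^ 2) := by
  have hk0 : k ≠ 0 := by omega
  have hs := supportAngle_perturbedDisc (k := k) hε hε2 hkε
  have hT : ∀ {g : ℝ → ℝ}, Continuous g → IntervalIntegrable g volume 0 (2 * π) :=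
    fun hg => hg.intervalIntegrable _ _
  obtain ⟨hkc, hks⟩ := integral_cos_nat_mul_harmonic hk
  have hI : ∫ θ in 0..2 * π, supportAngle (perturbedDisc k ε) θ = 2 * π := by
    rw [hs, intervalIntegral.integral_add (hT (by fun_prop)) (hT (by fun_prop)),
      intervalIntegral.integral_const_mul, integral_cos_nat_mul hk0]
    simp
  have hJ : ∫ θ in 0..2 * π, supportAngle (perturbedDisc k ε) θ ^ 2 = 2 * π + π * ε ^ 2 := by
    simp only [hs]
    calc _ = ∫ θ in 0..2 * π, (1 + 2 * ε * Real.cos (k * θ)) + ε ^ 2 * Real.cos (k * θ) ^ 2 :=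
          intervalIntegral.integral_congr fun θ _ => by ring
      _ = _ := by
        rw [intervalIntegral.integral_add (hT (by fun_prop)) (hT (by fun_prop)),
          intervalIntegral.integral_add (hT (by fun_prop)) (hT (by fun_prop)),
          intervalIntegral.integral_const_mul, intervalIntegral.integral_const_mul,
          integral_cos_nat_mul hk0, integral_cos_nat_mul_sq hk0]
        simp
        ring
  have hA : ∫ θ in 0..2 * π, supportAngle (perturbedDisc k ε) θ * Real.cos θ = 0 := by
    simp only [hs, add_mul, one_mul, mul_assoc]
    rw [intervalIntegral.integral_add (hT (by fun_prop)) (hT (by fun_prop)),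
      intervalIntegral.integral_const_mul, hkc, integral_cos_period]
    simp
  have hB : ∫ θ in 0..2 * π, supportAngle (perturbedDisc k ε) θ * Real.sin θ = 0 := by
    simp only [hs, add_mul, one_mul, mul_assoc]
    rw [intervalIntegral.integral_add (hT (by fun_prop)) (hT (by fun_prop)),
      intervalIntegral.integral_const_mul, hks, integral_sin_period]
    simp
  have hD : ∫ θ in 0..2 * π, deriv (supportAngle (perturbedDisc k ε)) θ ^ 2 =
      k ^ 2 * (π * ε ^ 2) := by
    have hd : ∀ θ : ℝ, deriv (supportAngle (perturbedDisc k ε)) θ =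
        ε * (-(k * Real.sin (k * θ))) := fun θ => by
      rw [hs]
      exact (((hasDerivAt_cos_mul k θ).const_mul ε).const_add 1).deriv
    calc _ = ∫ θ in 0..2 * π, (k ^ 2 * ε ^ 2) * Real.sin (k * θ) ^ 2 :=
          intervalIntegral.integral_congr fun θ _ => by
            simp only [hd]
            ring
      _ = _ := by
        rw [intervalIntegral.integral_const_mul, integral_sin_nat_mul_sq hk0]
        ring
  have hV : firstHarmonicEnergy (perturbedDisc k ε) = 0 := by
    rw [firstHarmonicEnergy, hA, hB]
    simp
  refine ⟨hV, ?_, ?_⟩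
  · rw [higherHarmonicEnergy, hV, hI, hJ]
    field_simp
    ring
  · rw [higherDerivEnergy, hV, hD, sub_zero]

theorem exists_energies {k : ℕ} (hk : 2 ≤ k) : ∃ (E : Set Plane) (_ : IsPlanarConvex E),
    firstHarmonicEnergy E = 0 ∧ 0 < higherHarmonicEnergy E ∧
      higherDerivEnergy E = k ^ 2 * higherHarmonicEnergy E := by
  have hk2 : (2 : ℝ) ≤ k := by exact_mod_cast hk
  have hC : (2 : ℝ) ≤ (k + 1) * (1 + k ^ 2) := by nlinarith
  have hC0 : (0 : ℝ) < (k + 1) * (1 + k ^ 2) := by positivity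
  -- The largest amplitude allowed by `support_inequality_cos`.
  set ε : ℝ := 1 / ((k + 1) * (1 + k ^ 2)) with hε
  have hε0 : 0 < ε := by positivity
  have hε2 : ε ≤ 1 / 2 := one_div_le_one_div_of_le two_pos hC
  have hkε : ε * ((k + 1) * (1 + k ^ 2)) ≤ 1 := by
    rw [hε, one_div_mul_cancel hC0.ne']
  obtain ⟨h1, h2, h3⟩ := energies_perturbedDisc hk hε0.le hε2 hkε
  exact ⟨perturbedDisc k ε, isPlanarConvex_perturbedDisc hε0.le hε2, h1, by rw [h2]; positivity,
    by rw [h3, h2]⟩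

end

/-! ### The inequalities, their sharpness and the equality cases -/

theorem higherDerivEnergy_eq_zero {E : Set Plane} (hE : IsPlanarConvex E)
    (h : higherHarmonicEnergy E = 0) : higherDerivEnergy E = 0 :=
  (energies_of_supportAngle_eq hE.isBounded
    (supportAngle_eq_of_higherHarmonicEnergy_eq_zero hE.isBounded h)).2.1

theorem mainTheorem5 (β : ℝ) (hβ : 0 < β) :
    -- the lower bound
    (β ≤ 1 → ∀ (E : Set Plane) (hE : IsPlanarConvex E),
      (∫ x, ‖x‖ ^ 2 ∂(curvatureMeasure E hE.isBounded)) + 2 * β * area E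
          ≥ (1 + β) * (perimeter E ^ 2 / (2 * π)) ∧
      (⨅ x₀ : Plane, curvatureMoment E hE.isBounded x₀) + 2 * β * area E
          ≥ (1 + β) * (perimeter E ^ 2 / (2 * π))) ∧
    -- the upper bound
    (5 / 3 ≤ β → ∀ (E : Set Plane) (hE : IsPlanarConvex E),
      (⨅ x₀ : Plane, curvatureMoment E hE.isBounded x₀) + 2 * β * area E
          ≤ (1 + β) * (perimeter E ^ 2 / (2 * π))) ∧
    -- sharpness of the threshold 1
    (1 < β → ∃ (E : Set Plane) (hE : IsPlanarConvex E),
      (∫ x, ‖x‖ ^ 2 ∂(curvatureMeasure E hE.isBounded)) + 2 * β * area E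
          < (1 + β) * (perimeter E ^ 2 / (2 * π))) ∧
    -- sharpness of the threshold 5/3
    (β < 5 / 3 → ∃ (E : Set Plane) (hE : IsPlanarConvex E),
      (⨅ x₀ : Plane, curvatureMoment E hE.isBounded x₀) + 2 * β * area E
          > (1 + β) * (perimeter E ^ 2 / (2 * π))) ∧
    -- equality in the lower bound
    (β < 1 → ∀ (E : Set Plane) (hE : IsPlanarConvex E),
      ((∫ x, ‖x‖ ^ 2 ∂(curvatureMeasure E hE.isBounded)) + 2 * β * area E
          = (1 + β) * (perimeter E ^ 2 / (2 * π)) ↔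
        ∃ r : ℝ, 0 < r ∧ interior E = Metric.ball 0 r) ∧
      ((⨅ x₀ : Plane, curvatureMoment E hE.isBounded x₀) + 2 * β * area E
          = (1 + β) * (perimeter E ^ 2 / (2 * π)) ↔
        ∃ (r : ℝ) (c : Plane), 0 < r ∧ interior E = Metric.ball c r)) ∧
    -- equality in the upper bound
    (5 / 3 < β → ∀ (E : Set Plane) (hE : IsPlanarConvex E),
      ((⨅ x₀ : Plane, curvatureMoment E hE.isBounded x₀) + 2 * β * area E
          = (1 + β) * (perimeter E ^ 2 / (2 * π)) ↔
        ∃ (r : ℝ) (c : Plane), 0 < r ∧ interior E = Metric.ball c r)) := by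
  refine ⟨fun h1 E hE => ?_, fun h53 E hE => ?_, fun h1 => ?_, fun h53 => ?_, fun h1 E hE => ?_,
    fun h53 E hE => ?_⟩
  · have hW := higherHarmonicEnergy_nonneg hE.isBounded
    have hD := four_mul_higherHarmonicEnergy_le hE.isBounded
    have hV := firstHarmonicEnergy_nonneg E
    rw [integral_norm_sq_eq_energies hE, iInf_curvatureMoment_eq_energies hE]
    constructor <;> nlinarith
  · have hW := higherHarmonicEnergy_nonneg hE.isBounded
    have hD := four_mul_higherHarmonicEnergy_le hE.isBounded
    rw [iInf_curvatureMoment_eq_energies hE]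
    -- Since 1 - β < 0, the bound D ≥ 4W leaves at most (5 - 3β) W ≤ 0.
    nlinarith
  -- With D = K² W the excess is (1 + β - K² (β - 1)) W, negative for large K; K = k + 2 also
  -- secures the condition K ≥ 2.
  · obtain ⟨k, hk⟩ := exists_nat_gt ((1 + β) / (β - 1))
    obtain ⟨E, hE, hV, hW, hD⟩ := exists_energies (k := k + 2) (by omega)
    refine ⟨E, hE, ?_⟩
    rw [integral_norm_sq_eq_energies hE, hV, hD]
    rw [div_lt_iff₀ (by linarith)] at hk
    have hk0 : (0 : ℝ) ≤ k := Nat.cast_nonneg k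
    have hlt : 1 + β < ((k + 2 : ℕ) : ℝ) ^ 2 * (β - 1) := by
      push_cast
      nlinarith
    nlinarith
  -- Frequency 2 attains D = 4W, so the excess is exactly (5 - 3β) W > 0.
  · obtain ⟨E, hE, hV, hW, hD⟩ := exists_energies (k := 2) le_rfl
    refine ⟨E, hE, ?_⟩
    rw [iInf_curvatureMoment_eq_energies hE, hD]
    push_cast
    nlinarith
  · have hW := higherHarmonicEnergy_nonneg hE.isBounded
    have hD := four_mul_higherHarmonicEnergy_le hE.isBounded
    have hV := firstHarmonicEnergy_nonneg E
    have hD0 : 0 ≤ (1 - β) * higherDerivEnergy E := mul_nonneg (by linarith) (by linarith)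
    have hW0 : 0 ≤ (1 + β) * higherHarmonicEnergy E := by positivity
    rw [integral_norm_sq_eq_energies hE, iInf_curvatureMoment_eq_energies hE,
      ← energies_eq_zero_iff_centered_disc hE, ← higherHarmonicEnergy_eq_zero_iff hE]
    refine ⟨⟨fun h => ⟨?_, by linarith⟩, fun h => ?_⟩, fun h => ?_, fun h => ?_⟩
    · exact (mul_eq_zero.1 (by linarith : (1 + β) * higherHarmonicEnergy E = 0)).resolve_left
        (by positivity)
    · rw [higherDerivEnergy_eq_zero hE h.1, h.1, h.2]
      ring
    · exact (mul_eq_zero.1 (by linarith : (1 + β) * higherHarmonicEnergy E = 0)).resolve_left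
        (by positivity)
    · rw [higherDerivEnergy_eq_zero hE h, h]
      ring
  · have hW := higherHarmonicEnergy_nonneg hE.isBounded
    have hD := four_mul_higherHarmonicEnergy_le hE.isBounded
    rw [iInf_curvatureMoment_eq_energies hE, ← higherHarmonicEnergy_eq_zero_iff hE]
    refine ⟨fun h => ?_, fun h => ?_⟩
    -- Equality and D ≥ 4W give (5 - 3β) W ≥ 0 with 5 - 3β < 0, so W ≤ 0.
    · nlinarith
    · rw [higherDerivEnergy_eq_zero hE h, h]
      ring
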